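/- **Setting.** For $n=1,2,\dots$ consider $N=N_n\to\infty$ qubits on a line and a random Hamiltonian $H=\sum_i E_i|E_i\rangle\langle E_i|$ with given real energies $E_i$ and a random orthonormal eigenbasis $(|E_i\rangle)$. (All objects below depend on $n$, except the constants $\beta>0$, $c$ and $\lambda$.) An operator is $d$-local if it acts on at most $d$ consecutive qubits; an observable is a Hermitian operator. *Shell and entropy.* Fix a microcanonical shell $[E-\Delta,E+\Delta]$ and let $S=\ln\#\{i: |E_i-E|\le\Delta\}$ be its microcanonical entropy. Assume that $S$ is extensive, i.e. $N=O(S)$, and that the width of the shell is subextensive, $\Delta=o(N)$. *ETH.* For every $d$-local observable $A$ with $\|A\|\le 1$ there are smooth functions $\mathcal A(E)$, $f(E,\omega)$ such that for all eigenstates in the shell $$\langle E_i|A|E_j\rangle=\mathcal A(E)\,\delta_{ij}+e^{-S/2}f(E,\omega_{ij})R_{ij},\qquad \omega_{ij}=E_i-E_j,$$ with random variables $R_{ij}$ of zero mean and unit variance, and $|f(E,\omega)|\le c\,e^{-\beta|\omega|/4}$ for all $\omega$, with $c$ independent of $A$ and $n$. *Lyapunov exponent.* With $\rho=e^{-\beta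 H}/\operatorname{Tr}e^{-\beta H}$, $A(t)=e^{iHt}Ae^{-iHt}$ and a $d$-local observable $A=A_n$, let $F_2(t)$ and $F_{\rm OTO}(t)$ be the ensemble averages of $\operatorname{Tr}[\rho^{1/2}A(t)\rho^{1/2}A]$ and $\operatorname{Tr}[\rho^{1/4}A(t)\rho^{1/4}A\rho^{1/4}A(t)\rho^{1/4}A]$. The number $\lambda$ is the Lyapunov exponent: there are dissipation times $t_d$, bounded below by a positive constant, scrambling times $t_s$ with $t_d=o(t_s)$, and constants $C\neq 0$ (all depending on $n$) such that for all times $t=t_n>0$ with $t_d\ll t\ll t_s$ (i.e. $t_d=o(t)$, $t=o(t_s)$) one has $F_2(t)/F_2(0)\to0$ and $F_{\rm OTO}(t)=C\,(1-(1+o(1))e^{\lambda(t-t_s)})$. Assume that the chaos bound is saturated, $\lambda=2\pi/\beta$. *Code.* Let $\mathcal C$ be spanned by $2^k$ of the eigenstates in the shell (chosen by fixed labels). Its error $\varepsilon_{\rm code}$ is the smallest $\varepsilon\ge0$ for which it is an $[[N,k,d,\varepsilon]]$ approximate quantum error-correcting code: for every channel $\Lambda$ acting on at most $d$ consecutive qubits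 and every unit vector $\psi\in\mathcal C\otimes\mathbb C^{2^k}$ there is a decoding channel $\mathcal D$ with $\langle\psi|(\mathcal D\circ\Lambda\otimes I)(|\psi\rangle\langle\psi|)|\psi\rangle\ge1-\varepsilon$. **Theorem.** With probability tending to $1$ as $n\to\infty$ the following holds: if $\varepsilon_{\rm code}>0$, then for every energy difference $\omega=E_i-E_j$ of eigenstates spanning $\mathcal C$, $$2\ln\frac{2^{d+2k}}{\varepsilon_{\rm code}}-\frac S2>0\qquad\text{and}\qquad \lambda\ \ge\ \frac{\pi|\omega|}{2\ln\left(\frac{2^{d+2k}}{\varepsilon_{\rm code}}\right)-\frac S2}.$$ -/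

import Mathlib

open Matrix MeasureTheory Filter Topology Asymptotics
open scoped Kronecker

namespace ChaosCode

noncomputable section

/-! ### Qubits on a line -/

/-- Labels of the computational basis of `N` qubits. -/
abbrev Conf (N : ℕ) : Type := Fin N → Fin 2

/-- Operators on the `2 ^ N`-dimensional space of `N` qubits. -/
abbrev Op (N : ℕ) : Type := Matrix (Conf N) (Conf N) ℂ

/-- The (at most `d`) consecutive qubits `a, a + 1, …, a + d - 1`. -/
def window (N d a : ℕ) : Finset (Fin N) :=
  Finset.univ.filter fun q => a ≤ (q : ℕ) ∧ (q : ℕ) < a + d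

/-- `A` acts on the qubits of `W` only: `A = B_W ⊗ 1` for an operator `B` on the qubits in `W`. -/
def SupportedOn {N : ℕ} (W : Finset (Fin N)) (A : Op N) : Prop :=
  ∃ B : Matrix (W → Fin 2) (W → Fin 2) ℂ, ∀ x y : Conf N,
    A x y = if ∀ q, q ∉ W → x q = y q then B (fun q => x q) (fun q => y q) else 0

/-- A `d`-local observable: Hermitian, acting on at most `d` consecutive qubits. -/
def IsLocalObservable {N : ℕ} (d : ℕ) (A : Op N) : Prop :=
  A.IsHermitian ∧ ∃ a, SupportedOn (window N d a) A

/-! ### Approximate quantum error-correcting codes -/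

/-- The Kraus operators `K l` define a quantum channel `X ↦ ∑ l, K l X (K l)ᴴ`
(such a map is completely positive; this is the trace-preservation condition). -/
def IsChannel {n : Type*} [Fintype n] [DecidableEq n] {m : ℕ}
    (K : Fin m → Matrix n n ℂ) : Prop :=
  ∑ l, (K l)ᴴ * K l = 1

/-- The action of `Λ ⊗ id` on an operator of system and reference, `Λ` having Kraus operators
`K`. -/
def applyChannel {n r : Type*} [Fintype n] [Fintype r] [DecidableEq r] {m : ℕ}
    (K : Fin m → Matrix n n ℂ) (X : Matrix (n × r) (n × r) ℂ) : Matrix (n × r) (n × r) ℂ :=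
  ∑ l, (K l ⊗ₖ (1 : Matrix r r ℂ)) * X * (K l ⊗ₖ (1 : Matrix r r ℂ))ᴴ

/-- `⟨ψ| (𝒟 ∘ Λ ⊗ id)(|ψ⟩⟨ψ|) |ψ⟩`, where `D`, `K` are Kraus operators of `𝒟`, `Λ`. -/
def recoveryFidelity {n r : Type*} [Fintype n] [Fintype r] [DecidableEq r] {m m' : ℕ}
    (D : Fin m' → Matrix n n ℂ) (K : Fin m → Matrix n n ℂ) (ψ : n × r → ℂ) : ℝ :=
  (star ψ ⬝ᵥ (applyChannel D (applyChannel K (vecMulVec ψ (star ψ))) *ᵥ ψ)).re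

/-- `C` is an `[[N, k, d, ε]]` approximate quantum error-correcting code: `dim C = 2 ^ k`, and for
every channel on at most `d` consecutive qubits and every unit vector `ψ` in the tensor product of
`C` with a reference space of dimension `2 ^ k`, some decoding channel recovers `ψ` with
fidelity at least `1 - ε`. -/
def IsAQECC {N : ℕ} (k d : ℕ) (ε : ℝ) (C : Submodule ℂ (Conf N → ℂ)) : Prop :=
  Module.finrank ℂ C = 2 ^ k ∧
  ∀ (a m : ℕ) (K : Fin m → Op N), IsChannel K → (∀ l, SupportedOn (window N d a) (K l)) →
    ∀ ψ : Conf N × Fin (2 ^ k) → ℂ, (∀ r, (fun x => ψ (x, r)) ∈ C) → star ψ ⬝ᵥ ψ = 1 →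
      ∃ (m' : ℕ) (D : Fin m' → Op N), IsChannel D ∧ 1 - ε ≤ recoveryFidelity D K ψ

/-- The error of a code: the smallest `ε ≥ 0` for which it is an `[[N, k, d, ε]]` code. -/
def codeError {N : ℕ} (k d : ℕ) (C : Submodule ℂ (Conf N → ℂ)) : ℝ :=
  sInf {ε : ℝ | 0 ≤ ε ∧ IsAQECC k d ε C}

/-! ### Thermal correlators -/

/-- The power `ρ ^ s` of the thermal state `ρ = exp (-β H) / Z`, `Z = Tr exp (-β H)`. -/
def thermalPow {N : ℕ} (H : Op N) (β s : ℝ) : Op N :=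
  (((NormedSpace.exp ((-β : ℂ) • H)).trace.re ^ (-s) : ℝ) : ℂ) •
    NormedSpace.exp ((-(s * β) : ℂ) • H)

/-- Heisenberg evolution `A(t) = exp (i H t) A exp (-i H t)`. -/
def heisenberg {N : ℕ} (H A : Op N) (t : ℝ) : Op N :=
  NormedSpace.exp ((Complex.I * t) • H) * A * NormedSpace.exp ((-(Complex.I * t)) • H)

/-- The regulated two-point function `Tr[ρ^{1/2} A(t) ρ^{1/2} A]`. -/
def twoPoint {N : ℕ} (H A : Op N) (β t : ℝ) : ℂ :=
  (thermalPow H β (1 / 2) * heisenberg H A t * thermalPow H β (1 / 2) * A).trace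

/-- The regulated out-of-time-order correlator
`Tr[ρ^{1/4} A(t) ρ^{1/4} A ρ^{1/4} A(t) ρ^{1/4} A]`. -/
def otoc {N : ℕ} (H A : Op N) (β t : ℝ) : ℂ :=
  (thermalPow H β (1 / 4) * heisenberg H A t * thermalPow H β (1 / 4) * A *
    thermalPow H β (1 / 4) * heisenberg H A t * thermalPow H β (1 / 4) * A).trace

/-- `lam` is the Lyapunov exponent of a sequence of systems with two-point functions `F₂ n` and
out-of-time-order correlators `F n`. There are dissipation times `td`, bounded below, and
scrambling times `ts ≫ td`, such that at all times `td ≪ t ≪ ts` the two-point function has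
decayed, and `F n (t) ∝ 1 - exp (lam (t - ts))`, the exponential being correct up to a relative
error that vanishes in the limit. -/
def IsLyapunovExponent (F₂ F : ℕ → ℝ → ℂ) (lam : ℝ) : Prop :=
  ∃ td ts c : ℕ → ℝ,
    (∃ τ > 0, ∀ n, τ ≤ td n) ∧ (∀ n, 0 < ts n) ∧ (∀ n, c n ≠ 0) ∧ td =o[atTop] ts ∧
    ∀ t : ℕ → ℝ, (∀ n, 0 < t n) → td =o[atTop] t → t =o[atTop] ts →
      Tendsto (fun n => F₂ n (t n) / F₂ n 0) atTop (𝓝 0) ∧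
      Tendsto (fun n => (1 - F n (t n) / (c n : ℂ)) / (Real.exp (lam * (t n - ts n)) : ℂ))
        atTop (𝓝 1)

/-! ### Ensembles of Hamiltonians and the eigenstate thermalization hypothesis -/

/-- A random Hamiltonian on `N` qubits with given spectrum: energies `E i`, and a random
orthonormal basis of eigenvectors `|E i⟩`, the columns of the random unitary matrix `V`. -/
structure Ensemble (N : ℕ) (Ω : Type*) [MeasurableSpace Ω] where
  E : Conf N → ℝ
  V : Ω → Op N
  unitary : ∀ o, V o ∈ Matrix.unitaryGroup (Conf N) ℂ
  measurable : ∀ x i, Measurable fun o => V o x i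

namespace Ensemble

variable {N : ℕ} {Ω : Type*} [MeasurableSpace Ω] (Q : Ensemble N Ω)

/-- The Hamiltonian `∑ i, E i |E i⟩⟨E i|`. -/
def hamiltonian (o : Ω) : Op N :=
  Q.V o * Matrix.diagonal (fun i => (Q.E i : ℂ)) * (Q.V o)ᴴ

/-- The matrix element `⟨E i| A |E j⟩`. -/
def matrixElement (A : Op N) (i j : Conf N) (o : Ω) : ℂ :=
  ((Q.V o)ᴴ * A * Q.V o) i j

/-- The labels of the energies in the microcanonical shell `[E₀ - Δ, E₀ + Δ]`. -/
def shell (E₀ Δ : ℝ) : Finset (Conf N) :=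
  Finset.univ.filter fun i => |Q.E i - E₀| ≤ Δ

/-- The microcanonical entropy: the logarithm of the number of eigenstates in the shell. -/
def entropy (E₀ Δ : ℝ) : ℝ :=
  Real.log ((Q.shell E₀ Δ).card : ℝ)

/-- The eigenstate thermalization ansatz in the shell, for all normalized `d`-local observables `A`:
`⟨E i| A |E j⟩ = Abar(E₀) δ_ij + exp (-S / 2) f(E₀, ω) R_ij` with `ω = E i - E j`,
smooth functions `Abar`, `f` depending on `A`, random variables `R_ij` of zero mean and unit
variance, and spectral function `f(E₀, ω) ≲ exp (-β |ω| / 4)` with implied constant `c`. -/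
def SatisfiesETH (P : Measure Ω) (d : ℕ) (E₀ Δ β c : ℝ) : Prop :=
  ∀ A : Op N, IsLocalObservable d A → ‖Matrix.toEuclideanCLM (𝕜 := ℂ) A‖ ≤ 1 →
    ∃ (Abar : ℝ → ℝ) (f : ℝ × ℝ → ℝ) (R : Conf N → Conf N → Ω → ℂ),
      ContDiff ℝ (⊤ : ℕ∞) Abar ∧ ContDiff ℝ (⊤ : ℕ∞) f ∧
      (∀ w : ℝ, |f (E₀, w)| ≤ c * Real.exp (-(β / 4) * |w|)) ∧
      ∀ i ∈ Q.shell E₀ Δ, ∀ j ∈ Q.shell E₀ Δ,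
        MemLp (R i j) 2 P ∧ ∫ o, R i j o ∂P = 0 ∧ ∫ o, ‖R i j o‖ ^ 2 ∂P = 1 ∧
        ∀ᵐ o ∂P, Q.matrixElement A i j o =
          (if i = j then (Abar E₀ : ℂ) else 0) +
            ((Real.exp (-(Q.entropy E₀ Δ) / 2) * f (E₀, Q.E i - Q.E j) : ℝ) : ℂ) * R i j o

/-- The code spanned by the eigenstates with labels `s r`. -/
def codeSpace {K : ℕ} (s : Fin K ↪ Conf N) (o : Ω) : Submodule ℂ (Conf N → ℂ) :=
  Submodule.span ℂ (Set.range fun r x => Q.V o x (s r))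

end Ensemble

end

end ChaosCode

/-! With λ = 2π/β and D = 2 ln(2^(d+2k)/ε) - S/2, the claim is D > 0 and β|ω| ≤ 2D. Both energies
lie in the shell, so |ω| ≤ 2|Δ| = o(N). It therefore suffices that, with high probability, D is
bounded below by a positive multiple of S up to O(log N), because S is extensive. This amounts to an
exponentially small upper bound on the code error ε.

That bound comes from approximate Knill-Laflamme conditions. ETH says that matrix elements of a
local observable between shell eigenstates deviate from a multiple of the identity by about e^(-S/2)
in mean square. Summed over the matrix units of a window and over pairs of code states, this gives
`knillLaflammeError` an exponentially small mean (`SatisfiesETH.knillLaflammeError_moment_le`), and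
Markov's inequality makes it small for all windows at once (`SatisfiesETH.prob_codeError_le`).

Small Knill-Laflamme error means that the reduced state of ψ on window and reference is nearly a
product (`decoupling_error_le`). A quantitative Uhlmann theorem (`exists_contraction_overlap`),
resting on a Powers-Størmer inequality, then yields a decoder acting on the complement of the window
alone, which undoes every channel on that window (`exists_decoder_of_decoupled`).

The resulting estimate is ε² ≤ 2^(3d) 2^(4k) e^(-S) up to a factor polynomial in N. Together with ε
≤ 1 it gives D ≥ S/6 - O(log N) uniformly in d and k (`log_le_of_le_one_of_le_sqrt`). -/

namespace ChaosCode

/-! ### Polar decomposition, Powers-Størmer and Uhlmann. -/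

section LinearAlgebra

open scoped ComplexOrder

variable {m n p : Type*} [Fintype m] [Fintype n] [Fintype p]

lemma posSemidef_one_sub_of_partialIsometry [DecidableEq n] {U : Matrix m n ℂ}
    (hU : U * Uᴴ * U = U) : (1 - Uᴴ * U).PosSemidef := by
  have h : 1 - Uᴴ * U = (1 - Uᴴ * U)ᴴ * (1 - Uᴴ * U) := by
    have h2 : Uᴴ * U * (Uᴴ * U) = Uᴴ * U := by
      rw [Matrix.mul_assoc, ← Matrix.mul_assoc U, hU]
    simp only [conjTranspose_sub, conjTranspose_one, conjTranspose_mul, conjTranspose_conjTranspose]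
    rw [Matrix.sub_mul, Matrix.mul_sub, Matrix.mul_sub, h2]
    simp
  rw [h]
  exact posSemidef_conjTranspose_mul_self _

lemma posSemidef_one_sub_self_mul_of_partialIsometry [DecidableEq m] {U : Matrix m n ℂ}
    (hU : U * Uᴴ * U = U) : (1 - U * Uᴴ).PosSemidef := by
  have h := posSemidef_one_sub_of_partialIsometry (U := Uᴴ)
    (by simpa [Matrix.mul_assoc] using congrArg conjTranspose hU)
  simpa using h

/-- A spectral decomposition written with a plain unitary matrix. -/
lemma exists_spectral_decomposition [DecidableEq m] {A : Matrix m m ℂ} (hA : A.IsHermitian) :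
    ∃ W : Matrix m m ℂ, Wᴴ * W = 1 ∧ W * Wᴴ = 1 ∧
      A = W * diagonal (fun i => (hA.eigenvalues i : ℂ)) * Wᴴ := by
  refine ⟨hA.eigenvectorUnitary, ?_, ?_, ?_⟩
  · exact Unitary.coe_star_mul_self hA.eigenvectorUnitary
  · exact Unitary.coe_mul_star_self hA.eigenvectorUnitary
  · exact hA.spectral_theorem

/-- Polar decomposition: a partial isometry `U` and `P = (A Aᴴ) ^ (1 / 2)` with `A Uᴴ = P`. -/
lemma exists_polar [DecidableEq m] (A : Matrix m n ℂ) :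
    ∃ (U : Matrix m n ℂ) (P : Matrix m m ℂ), U * Uᴴ * U = U ∧ P.PosSemidef ∧
      P * P = A * Aᴴ ∧ A * Uᴴ = P := by
  have hpsd : (A * Aᴴ).PosSemidef := posSemidef_self_mul_conjTranspose A
  obtain ⟨W, hW1, hW2, hA⟩ := exists_spectral_decomposition hpsd.1
  set lam := hpsd.1.eigenvalues with hlam
  have hnn : ∀ i, 0 ≤ lam i := hpsd.eigenvalues_nonneg
  -- Since `0⁻¹ = 0`, `G` is the pseudo-inverse of `P`. Hence `G * A` is a partial isometry even
  -- when `A * Aᴴ` is singular.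
  set G : Matrix m m ℂ := W * diagonal (fun i => (((Real.sqrt (lam i))⁻¹ : ℝ) : ℂ)) * Wᴴ with hG
  set P : Matrix m m ℂ := W * diagonal (fun i => ((Real.sqrt (lam i) : ℝ) : ℂ)) * Wᴴ with hP
  have key : ∀ f g : m → ℂ, W * diagonal f * Wᴴ * (W * diagonal g * Wᴴ) =
      W * diagonal (fun i => f i * g i) * Wᴴ := by
    intro f g
    rw [← diagonal_mul_diagonal]
    simp only [Matrix.mul_assoc]
    rw [← Matrix.mul_assoc Wᴴ W, hW1, Matrix.one_mul]
  have hGH : Gᴴ = G := by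
    rw [hG]
    simp only [conjTranspose_mul, conjTranspose_conjTranspose, diagonal_conjTranspose,
      Matrix.mul_assoc]
    congr 3
    ext i
    simp
  have hAG : A * Aᴴ * G = P := by
    rw [hA, hG, key, hP]
    congr 3
    ext i
    rw [← Complex.ofReal_mul]
    congr 1
    rw [← div_eq_mul_inv, Real.div_sqrt]
  have hGP : G * P * G = G := by
    rw [hG, hP, key, key]
    congr 3
    ext i
    rw [← Complex.ofReal_mul, ← Complex.ofReal_mul]
    congr 1
    by_cases h : Real.sqrt (lam i) = 0
    · simp [h]
    · field_simp
  refine ⟨G * A, P, ?_, ?_, ?_, ?_⟩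
  · rw [conjTranspose_mul, hGH]
    calc G * A * (Aᴴ * G) * (G * A) = G * (A * Aᴴ * G) * G * A := by
          simp only [Matrix.mul_assoc]
      _ = G * A := by rw [hAG, hGP]
  · rw [hP]
    apply PosSemidef.mul_mul_conjTranspose_same
    rw [posSemidef_diagonal_iff]
    intro i
    exact_mod_cast Real.sqrt_nonneg _
  · rw [hP, key, hA]
    congr 3
    ext i
    rw [← Complex.ofReal_mul, Real.mul_self_sqrt (hnn i)]
  · rw [conjTranspose_mul, hGH, ← Matrix.mul_assoc, hAG]

lemma PosSemidef.exists_eq_conjTranspose_mul_self [DecidableEq m] {A : Matrix m m ℂ}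
    (hA : A.PosSemidef) : ∃ Y : Matrix m m ℂ, A = Yᴴ * Y := by
  obtain ⟨W, hW1, hW2, h⟩ := exists_spectral_decomposition hA.1
  refine ⟨diagonal (fun i => ((Real.sqrt (hA.1.eigenvalues i) : ℝ) : ℂ)) * Wᴴ, ?_⟩
  nth_rewrite 1 [h]
  simp only [conjTranspose_mul, conjTranspose_conjTranspose, diagonal_conjTranspose,
    Matrix.mul_assoc]
  rw [← Matrix.mul_assoc (diagonal _) (diagonal _), diagonal_mul_diagonal]
  congr 3
  ext i
  simp only [Pi.star_apply, RCLike.star_def, Complex.conj_ofReal]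
  rw [← Complex.ofReal_mul, Real.mul_self_sqrt (hA.eigenvalues_nonneg i)]

/-- The square of the Hilbert-Schmidt norm. -/
lemma trace_conjTranspose_mul_self_re (X : Matrix m n ℂ) :
    (Xᴴ * X).trace.re = ∑ i, ∑ j, ‖X i j‖ ^ 2 := by
  rw [Finset.sum_comm]
  simp only [trace, diag_apply, mul_apply, conjTranspose_apply, Complex.re_sum]
  refine Finset.sum_congr rfl fun j _ => Finset.sum_congr rfl fun i _ => ?_
  rw [RCLike.star_def, ← Complex.normSq_eq_conj_mul_self, Complex.ofReal_re,
    Complex.normSq_eq_norm_sq]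

/-- A Powers-Størmer inequality, with the trace norm estimated by the Hilbert-Schmidt norm. -/
lemma trace_sub_mul_sub_le [DecidableEq m] {P Q : Matrix m m ℂ} (hP : P.PosSemidef)
    (hQ : Q.PosSemidef) :
    ((P - Q) * (P - Q)).trace.re ≤
      √((Fintype.card m : ℝ) * ∑ i, ∑ j, ‖(P * P - Q * Q) i j‖ ^ 2) := by
  have hD : (P - Q).IsHermitian := hP.1.sub hQ.1
  obtain ⟨W, hW1, hW2, hA⟩ := exists_spectral_decomposition hD
  set mu := hD.eigenvalues with hmu
  have hconj : ∀ A B : Matrix m m ℂ, Wᴴ * A * W * (Wᴴ * B * W) = Wᴴ * (A * B) * W := by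
    intro A B
    calc Wᴴ * A * W * (Wᴴ * B * W) = Wᴴ * A * (W * Wᴴ) * B * W := by
          simp only [Matrix.mul_assoc]
      _ = Wᴴ * (A * B) * W := by rw [hW2]; simp [Matrix.mul_assoc]
  have htr : ∀ A : Matrix m m ℂ, (Wᴴ * A * W).trace = A.trace := by
    intro A
    rw [Matrix.trace_mul_comm, ← Matrix.mul_assoc, hW2, Matrix.one_mul]
  have hP' : (Wᴴ * P * W).PosSemidef := hP.conjTranspose_mul_mul_same W
  have hQ' : (Wᴴ * Q * W).PosSemidef := hQ.conjTranspose_mul_mul_same W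
  set P' := Wᴴ * P * W with hP'd
  set Q' := Wᴴ * Q * W with hQ'd
  have hdiff : P' - Q' = diagonal (fun i => (mu i : ℂ)) := by
    rw [hP'd, hQ'd, ← Matrix.sub_mul, ← Matrix.mul_sub, hA]
    calc Wᴴ * (W * diagonal (fun i => (mu i : ℂ)) * Wᴴ) * W
        = (Wᴴ * W) * diagonal (fun i => (mu i : ℂ)) * (Wᴴ * W) := by simp only [Matrix.mul_assoc]
      _ = _ := by rw [hW1]; simp
  have htrace : ((P - Q) * (P - Q)).trace.re = ∑ i, mu i ^ 2 := by
    rw [← htr, ← hconj, Matrix.mul_sub, Matrix.sub_mul, ← hP'd, ← hQ'd, hdiff,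
      diagonal_mul_diagonal, trace_diagonal, Complex.re_sum]
    refine Finset.sum_congr rfl fun i _ => ?_
    rw [← Complex.ofReal_mul, Complex.ofReal_re, sq]
  set X := P * P - Q * Q with hX
  -- P² - Q² = (P - Q)P + Q(P - Q). In the eigenbasis of P - Q its diagonal is μᵢ(P'ᵢᵢ + Q'ᵢᵢ), and
  -- positivity gives |μᵢ| = |P'ᵢᵢ - Q'ᵢᵢ| ≤ P'ᵢᵢ + Q'ᵢᵢ.
  have hX' : Wᴴ * X * W = diagonal (fun i => (mu i : ℂ)) * P' +
      Q' * diagonal (fun i => (mu i : ℂ)) := by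
    rw [← hdiff, hX, Matrix.mul_sub, Matrix.sub_mul, ← hconj, ← hconj, ← hP'd, ← hQ'd,
      Matrix.sub_mul, Matrix.mul_sub]
    abel
  have hnorm : ∑ i, ∑ j, ‖(Wᴴ * X * W) i j‖ ^ 2 = ∑ i, ∑ j, ‖X i j‖ ^ 2 := by
    rw [← trace_conjTranspose_mul_self_re, ← trace_conjTranspose_mul_self_re]
    have : (Wᴴ * X * W)ᴴ = Wᴴ * Xᴴ * W := by simp [Matrix.mul_assoc]
    rw [this, hconj, htr]
  have hdiag : ∀ i, mu i ^ 2 ≤ ‖(Wᴴ * X * W) i i‖ := by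
    intro i
    have h1 := hP'.diag_nonneg (i := i)
    have h2 := hQ'.diag_nonneg (i := i)
    have h3 : P' i i - Q' i i = (mu i : ℂ) := by
      have := congrFun (congrFun hdiff i) i
      simpa using this
    have h4 : (Wᴴ * X * W) i i = (mu i : ℂ) * (P' i i + Q' i i) := by
      rw [hX', Matrix.add_apply, diagonal_mul, mul_diagonal]; ring
    rw [Complex.le_def] at h1 h2
    have h5 : (P' i i).re - (Q' i i).re = mu i := by
      have := congrArg Complex.re h3
      simpa using this
    have h6 : mu i ^ 2 ≤ |mu i| * ((P' i i).re + (Q' i i).re) := by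
      rw [← sq_abs, sq]
      refine mul_le_mul_of_nonneg_left ?_ (abs_nonneg _)
      rw [← h5, abs_le]
      have := h1.1; have := h2.1
      simp only [Complex.zero_re] at *
      constructor <;> linarith
    rw [h4, norm_mul, Complex.norm_real, Real.norm_eq_abs]
    refine h6.trans (mul_le_mul_of_nonneg_left ?_ (abs_nonneg _))
    rw [← Complex.add_re]
    exact Complex.re_le_norm _
  rw [htrace, ← hnorm]
  refine Real.le_sqrt_of_sq_le ?_
  calc (∑ i, mu i ^ 2) ^ 2 ≤ (∑ i, ‖(Wᴴ * X * W) i i‖) ^ 2 := by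
        gcongr with i
        exact hdiag i
    _ ≤ (Fintype.card m : ℝ) * ∑ i, ‖(Wᴴ * X * W) i i‖ ^ 2 := by
        simpa using sq_sum_le_card_mul_sum_sq (s := Finset.univ) (f := fun i => ‖(Wᴴ * X * W) i i‖)
    _ ≤ _ := by
        gcongr with i
        exact Finset.single_le_sum (f := fun j => ‖(Wᴴ * X * W) i j‖ ^ 2)
          (fun j _ => by positivity) (Finset.mem_univ i)

/-- A quantitative Uhlmann theorem: if `Ψ Ψᴴ` and `Θ Θᴴ` are close, the purifications `Ψ`, `Θ`
have a large overlap after a contraction of the purifying system. -/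
lemma exists_contraction_overlap [DecidableEq m] [DecidableEq n] (Ψ : Matrix m n ℂ)
    (Θ : Matrix m p ℂ) (hΨ : (Ψ * Ψᴴ).trace = 1) (hΘ : (Θ * Θᴴ).trace = 1) :
    ∃ C : Matrix n p ℂ, (1 - C * Cᴴ).PosSemidef ∧
      1 - √((Fintype.card m : ℝ) * ∑ i, ∑ j, ‖(Ψ * Ψᴴ - Θ * Θᴴ) i j‖ ^ 2) ≤
        ‖(Ψ * C * Θᴴ).trace‖ ^ 2 := by
  obtain ⟨U₁, P, hU₁, hP, hPP, hPU⟩ := exists_polar Ψ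
  obtain ⟨U₂, Q, hU₂, hQ, hQQ, hQU⟩ := exists_polar Θ
  refine ⟨U₁ᴴ * U₂, ?_, ?_⟩
  · have h : 1 - U₁ᴴ * U₂ * (U₁ᴴ * U₂)ᴴ =
        (1 - U₁ᴴ * U₁) + U₁ᴴ * (1 - U₂ * U₂ᴴ) * U₁ := by
      simp only [conjTranspose_mul, conjTranspose_conjTranspose, Matrix.mul_sub, Matrix.sub_mul,
        Matrix.mul_one, Matrix.mul_assoc]
      abel
    rw [h]
    exact (posSemidef_one_sub_of_partialIsometry hU₁).add
      ((posSemidef_one_sub_self_mul_of_partialIsometry hU₂).conjTranspose_mul_mul_same U₁)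
  · have h1 : Ψ * (U₁ᴴ * U₂) * Θᴴ = P * Q := by
      have : U₂ * Θᴴ = Q := by
        have := congrArg conjTranspose hQU
        rw [hQ.1] at this
        simpa using this
      rw [← Matrix.mul_assoc, Matrix.mul_assoc, this, hPU]
    have h2 := trace_sub_mul_sub_le hP hQ
    have h3 : ((P - Q) * (P - Q)).trace.re = 2 - 2 * (P * Q).trace.re := by
      rw [Matrix.sub_mul, Matrix.mul_sub, Matrix.mul_sub, hPP, hQQ]
      simp only [trace_sub, hΨ, hΘ, Matrix.trace_mul_comm Q P]
      simp
      ring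
    rw [h1]
    rw [h3, hPP, hQQ] at h2
    have h4 : (P * Q).trace.re ^ 2 ≤ ‖(P * Q).trace‖ ^ 2 := by
      rw [← Complex.normSq_eq_norm_sq, Complex.normSq_apply]
      nlinarith [sq_nonneg (P * Q).trace.im]
    -- With x = Re tr PQ, x² ≥ 2x - 1 = 1 - tr (P - Q)².
    nlinarith [sq_nonneg ((P * Q).trace.re - 1)]

end LinearAlgebra

/-! ### Fidelity of recovery and the decoder of a decoupled state. -/

section Recovery

open scoped ComplexOrder

variable {S X Z R T : Type*} [Fintype S] [Fintype X] [Fintype Z] [Fintype R]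

lemma star_dotProduct_self_eq (v : S → ℂ) : star v ⬝ᵥ v = ((∑ s, ‖v s‖ ^ 2 : ℝ) : ℂ) := by
  simp only [dotProduct, Pi.star_apply, RCLike.star_def, Complex.ofReal_sum]
  refine Finset.sum_congr rfl fun s _ => ?_
  rw [← Complex.normSq_eq_conj_mul_self, Complex.normSq_eq_norm_sq]

lemma sum_norm_sq_eq_one {v : S → ℂ} (hv : star v ⬝ᵥ v = 1) : ∑ s, ‖v s‖ ^ 2 = 1 := by
  rw [star_dotProduct_self_eq] at hv
  exact_mod_cast hv

lemma IsChannel.sum_norm_sq_mulVec [DecidableEq X] {m : ℕ} {B : Fin m → Matrix X X ℂ}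
    (hB : IsChannel B) (g : X → ℂ) :
    ∑ l, ∑ x, ‖(B l *ᵥ g) x‖ ^ 2 = ∑ x, ‖g x‖ ^ 2 := by
  have h : ∑ l, star (B l *ᵥ g) ⬝ᵥ (B l *ᵥ g) = star g ⬝ᵥ g := by
    have h1 : ∀ l, star (B l *ᵥ g) ⬝ᵥ (B l *ᵥ g) = star g ⬝ᵥ (((B l)ᴴ * B l) *ᵥ g) := by
      intro l
      rw [star_mulVec, ← dotProduct_mulVec, mulVec_mulVec]
    simp only [h1]
    rw [← dotProduct_sum, ← sum_mulVec]
    rw [IsChannel] at hB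
    rw [hB, one_mulVec]
  simp only [star_dotProduct_self_eq] at h
  exact_mod_cast h

lemma star_dotProduct_conj_vecMulVec_mulVec (A : Matrix S S ℂ) (ψ : S → ℂ) :
    star ψ ⬝ᵥ ((A * vecMulVec ψ (star ψ) * Aᴴ) *ᵥ ψ) = ((‖star ψ ⬝ᵥ (A *ᵥ ψ)‖ ^ 2 : ℝ) : ℂ) := by
  have h1 : A * vecMulVec ψ (star ψ) * Aᴴ = vecMulVec (A *ᵥ ψ) (star (A *ᵥ ψ)) := by
    rw [mul_vecMulVec, vecMulVec_mul, star_mulVec]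
  have h2 : star (A *ᵥ ψ) ⬝ᵥ ψ = star (star ψ ⬝ᵥ (A *ᵥ ψ)) := by
    rw [star_dotProduct, dotProduct_comm]
  rw [h1, vecMulVec_mulVec, h2, dotProduct_smul, op_smul_eq_mul, RCLike.star_def,
    Complex.mul_conj, Complex.normSq_eq_norm_sq]

/-- As a sum of squared amplitudes over pairs of Kraus operators, the fidelity can only grow when
Kraus operators are added to the decoder. -/
lemma recoveryFidelity_eq_sum [DecidableEq R] {m m' : ℕ} (D : Fin m' → Matrix S S ℂ)
    (K : Fin m → Matrix S S ℂ) (ψ : S × R → ℂ) :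
    recoveryFidelity D K ψ =
      ∑ l', ∑ l, ‖star ψ ⬝ᵥ (((D l' * K l) ⊗ₖ (1 : Matrix R R ℂ)) *ᵥ ψ)‖ ^ 2 := by
  have h : star ψ ⬝ᵥ (applyChannel D (applyChannel K (vecMulVec ψ (star ψ))) *ᵥ ψ) =
      ∑ l', ∑ l, ((‖star ψ ⬝ᵥ (((D l' * K l) ⊗ₖ (1 : Matrix R R ℂ)) *ᵥ ψ)‖ ^ 2 : ℝ) : ℂ) := by
    unfold applyChannel
    rw [sum_mulVec, dotProduct_sum]
    refine Finset.sum_congr rfl fun l' _ => ?_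
    rw [Matrix.mul_sum, Matrix.sum_mul, sum_mulVec, dotProduct_sum]
    refine Finset.sum_congr rfl fun l _ => ?_
    rw [← star_dotProduct_conj_vecMulVec_mulVec]
    have h1 : (D l' * K l) ⊗ₖ (1 : Matrix R R ℂ) =
        (D l' ⊗ₖ (1 : Matrix R R ℂ)) * (K l ⊗ₖ (1 : Matrix R R ℂ)) := by
      rw [← mul_kronecker_mul, Matrix.one_mul]
    rw [h1, conjTranspose_mul]
    simp only [Matrix.mul_assoc]
  rw [recoveryFidelity, h]
  simp only [Complex.re_sum, Complex.ofReal_re]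

lemma recoveryFidelity_nonneg [DecidableEq R] {m m' : ℕ} (D : Fin m' → Matrix S S ℂ)
    (K : Fin m → Matrix S S ℂ) (ψ : S × R → ℂ) : 0 ≤ recoveryFidelity D K ψ := by
  rw [recoveryFidelity_eq_sum]
  positivity

/-- A trace-nonincreasing completely positive map can be completed to a channel, which does not
decrease the fidelity of recovery. -/
lemma exists_isChannel_of_subnormalized {T : Type*} [Fintype T] [DecidableEq S] [DecidableEq R]
    (D : T → Matrix S S ℂ)
    (hD : (1 - ∑ i, (D i)ᴴ * D i).PosSemidef) :
    ∃ (m' : ℕ) (D' : Fin m' → Matrix S S ℂ), IsChannel D' ∧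
      ∀ (m : ℕ) (K : Fin m → Matrix S S ℂ) (ψ : S × R → ℂ),
        ∑ i, ∑ l, ‖star ψ ⬝ᵥ (((D i * K l) ⊗ₖ (1 : Matrix R R ℂ)) *ᵥ ψ)‖ ^ 2 ≤
          recoveryFidelity D' K ψ := by
  obtain ⟨Y, hY⟩ := PosSemidef.exists_eq_conjTranspose_mul_self hD
  let e := Fintype.equivFin (Option T)
  let G : Option T → Matrix S S ℂ := fun o => o.elim Y D
  refine ⟨Fintype.card (Option T), fun i => G (e.symm i), ?_, ?_⟩
  · rw [IsChannel, Equiv.sum_comp e.symm (fun o => (G o)ᴴ * G o), Fintype.sum_option]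
    simp only [G, Option.elim_none, Option.elim_some]
    rw [← hY]
    abel
  · intro m K ψ
    rw [recoveryFidelity_eq_sum, Equiv.sum_comp e.symm
      (fun o => ∑ l, ‖star ψ ⬝ᵥ (((G o * K l) ⊗ₖ (1 : Matrix R R ℂ)) *ᵥ ψ)‖ ^ 2),
      Fintype.sum_option]
    simp only [G, Option.elim_none, Option.elim_some]
    exact le_add_of_nonneg_left (by positivity)

/-- The Kraus operators, with labels `(x, t)`, of the map that discards the factor `X` of
`S ≃ X × Z`, applies the transpose of `C` to the factor `Z`, and discards `T`. -/
def discardKraus [DecidableEq X] (e : S ≃ X × Z) (C : Matrix Z (S × T) ℂ) (i : X × T) :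
    Matrix S S ℂ :=
  fun s s' => if (e s').1 = i.1 then C (e s').2 (s, i.2) else 0

/-- Tracing out `X` contributes the identity on `X`, so the sum of the `Dᴴ * D` is 1 ⊗ (C Cᴴ)ᵀ. -/
lemma discardKraus_subnormalized [Fintype T] [DecidableEq S] [DecidableEq X] [DecidableEq Z]
    (e : S ≃ X × Z) (C : Matrix Z (S × T) ℂ) (hC : (1 - C * Cᴴ).PosSemidef) :
    (1 - ∑ i, (discardKraus e C i)ᴴ * discardKraus e C i).PosSemidef := by
  have h : 1 - ∑ i, (discardKraus e C i)ᴴ * discardKraus e C i =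
      ((1 : Matrix X X ℂ) ⊗ₖ (1 - C * Cᴴ)ᵀ).submatrix e e := by
    ext s s'
    simp only [Matrix.sub_apply, Matrix.sum_apply, mul_apply, conjTranspose_apply, discardKraus,
      submatrix_apply, kroneckerMap_apply, transpose_apply, Fintype.sum_prod_type]
    by_cases hx : (e s).1 = (e s').1
    · have h1 : (1 : Matrix S S ℂ) s s' = (1 : Matrix Z Z ℂ) (e s').2 (e s).2 := by
        rw [one_apply, one_apply]
        exact if_congr ⟨fun h => by rw [h], fun h => e.injective (Prod.ext hx h.symm)⟩ rfl rfl
      rw [h1, hx, one_apply_eq, one_mul]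
      congr 1
      rw [Finset.sum_eq_single (e s').1]
      · simp only [if_true]
        rw [Finset.sum_comm]
        refine Finset.sum_congr rfl fun t _ => Finset.sum_congr rfl fun a _ => ?_
        rw [mul_comm]
      · intro b _ hb
        simp [Ne.symm hb]
      · simp
    · have h1 : s ≠ s' := fun h => hx (by rw [h])
      rw [one_apply_ne h1, one_apply_ne hx, zero_mul, zero_sub, neg_eq_zero]
      refine Finset.sum_eq_zero fun x _ => Finset.sum_eq_zero fun t _ =>
        Finset.sum_eq_zero fun a _ => ?_
      by_cases h2 : (e s).1 = x
      · have h3 : (e s').1 ≠ x := fun h => hx (h2.trans h.symm)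
        simp [h3]
      · simp [h2]
  rw [h]
  exact (PosSemidef.one.kronecker hC.transpose).submatrix e

/-- An error B ⊗ 1 reaches the decoder only through row `i.1` of `B`; the factor `C` does not see
it. This is why one decoder serves every channel on `X`. -/
lemma discardKraus_mul [DecidableEq X] [DecidableEq Z] (e : S ≃ X × Z)
    (C : Matrix Z (S × T) ℂ) {K : Matrix S S ℂ} {B : Matrix X X ℂ}
    (hK : ∀ s s', K s s' = if (e s).2 = (e s').2 then B (e s).1 (e s').1 else 0) (i : X × T)
    (s s' : S) :
    (discardKraus e C i * K) s s' = B i.1 (e s').1 * C (e s').2 (s, i.2) := by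
  simp only [mul_apply, discardKraus, hK]
  rw [← Equiv.sum_comp e.symm]
  simp only [Equiv.apply_symm_apply, Fintype.sum_prod_type]
  rw [Finset.sum_eq_single i.1]
  · simp [mul_comm]
  · intro x _ hx
    simp [hx]
  · simp

/-- Decoupling: if the reduced state of `ψ` on `X` and the reference `R` is close to the product
of the reduced state of `χ` on `X` and of `ψ` on `R`, all channels acting on `X` can be corrected. -/
theorem exists_decoder_of_decoupled [DecidableEq S] [DecidableEq X] [DecidableEq Z] [DecidableEq R]
    (e : S ≃ X × Z) (ψ : S × R → ℂ) (hψ : star ψ ⬝ᵥ ψ = 1) (χ : S → ℂ) (hχ : star χ ⬝ᵥ χ = 1)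
    {m : ℕ} {B : Fin m → Matrix X X ℂ} (hB : IsChannel B) {K : Fin m → Matrix S S ℂ}
    (hK : ∀ l s s', K l s s' = if (e s).2 = (e s').2 then B l (e s).1 (e s').1 else 0) :
    ∃ (m' : ℕ) (D : Fin m' → Matrix S S ℂ), IsChannel D ∧
      1 - √((Fintype.card X * Fintype.card R : ℝ) * ∑ x, ∑ y, ∑ r, ∑ r',
        ‖∑ z, ψ (e.symm (x, z), r) * star (ψ (e.symm (y, z), r')) -
          (∑ z, χ (e.symm (x, z)) * star (χ (e.symm (y, z)))) *
            ∑ s, ψ (s, r) * star (ψ (s, r'))‖ ^ 2) ≤ recoveryFidelity D K ψ := by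
  let Ψ : Matrix (X × R) Z ℂ := fun i z => ψ (e.symm (i.1, z), i.2)
  -- `Θ` purifies χ_X ⊗ ψ_R: its purifying system consists of a fresh copy of `S`, which restores ψ,
  -- and the partner `Z` of χ, which the decoder discards.
  let Θ : Matrix (X × R) (S × Z) ℂ := fun i j => ψ (j.1, i.2) * χ (e.symm (i.1, j.2))
  have hΨΨ : ∀ i j, (Ψ * Ψᴴ) i j =
      ∑ z, ψ (e.symm (i.1, z), i.2) * star (ψ (e.symm (j.1, z), j.2)) := fun i j => rfl
  have hΘΘ : ∀ i j, (Θ * Θᴴ) i j = (∑ z, χ (e.symm (i.1, z)) * star (χ (e.symm (j.1, z)))) *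
      ∑ s, ψ (s, i.2) * star (ψ (s, j.2)) := by
    intro i j
    rw [mul_apply, Fintype.sum_prod_type, Finset.sum_comm, Finset.sum_mul_sum]
    refine Finset.sum_congr rfl fun z _ => Finset.sum_congr rfl fun s _ => ?_
    rw [conjTranspose_apply]
    simp only [Θ, star_mul']
    ring
  have hχ' : ∑ x, ∑ z, χ (e.symm (x, z)) * star (χ (e.symm (x, z))) = 1 := by
    rw [← hχ, ← Fintype.sum_prod_type' (fun x z => χ (e.symm (x, z)) * star (χ (e.symm (x, z)))),
      dotProduct, ← Equiv.sum_comp e.symm]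
    exact Finset.sum_congr rfl fun i _ => mul_comm _ _
  have hψ' : ∑ r, ∑ s, ψ (s, r) * star (ψ (s, r)) = 1 := by
    rw [← hψ, Finset.sum_comm, dotProduct, Fintype.sum_prod_type]
    exact Finset.sum_congr rfl fun i _ => Finset.sum_congr rfl fun j _ => mul_comm _ _
  have hΨ : (Ψ * Ψᴴ).trace = 1 := by
    rw [← hψ']
    simp only [trace, diag_apply, hΨΨ]
    rw [Fintype.sum_prod_type, Finset.sum_comm]
    refine Finset.sum_congr rfl fun r _ => ?_
    rw [← Equiv.sum_comp e.symm, Fintype.sum_prod_type]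
  have hΘ : (Θ * Θᴴ).trace = 1 := by
    simp only [trace, diag_apply, hΘΘ, Fintype.sum_prod_type]
    rw [← Finset.sum_mul_sum, hχ', hψ', one_mul]
  obtain ⟨C, hC, hover⟩ := exists_contraction_overlap Ψ Θ hΨ hΘ
  obtain ⟨m', D, hD, hfid⟩ := exists_isChannel_of_subnormalized (R := R) _
    (discardKraus_subnormalized e C hC)
  refine ⟨m', D, hD, le_trans ?_ (hfid m K ψ)⟩
  -- `g t y` is the amplitude for finding ψ restored with residues `y` on `X` and `t` on the
  -- discarded `Z`. The channel merely rotates `g t` by the `B l`, preserving the total squared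
  -- norm, and Cauchy-Schwarz against χ bounds this norm below by the Uhlmann overlap.
  let g : Z → X → ℂ := fun t y => ∑ s, ∑ r, ∑ z,
    star (ψ (s, r)) * (C z (s, t) * ψ (e.symm (y, z), r))
  have hg : ∀ (i : X × Z) l, star ψ ⬝ᵥ (((discardKraus e C i * K l) ⊗ₖ (1 : Matrix R R ℂ)) *ᵥ ψ) =
      (B l *ᵥ g i.2) i.1 := by
    intro i l
    have h1 : ∀ s r, ((((discardKraus e C i * K l) ⊗ₖ (1 : Matrix R R ℂ)) *ᵥ ψ) (s, r)) =
        ∑ y, ∑ z, B l i.1 y * (C z (s, i.2) * ψ (e.symm (y, z), r)) := by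
      intro s r
      simp only [mulVec, dotProduct, kroneckerMap_apply, Fintype.sum_prod_type, one_apply,
        mul_ite, mul_one, mul_zero, ite_mul, zero_mul, Finset.sum_ite_eq, Finset.mem_univ, if_true,
        discardKraus_mul e C (hK l)]
      rw [← Equiv.sum_comp e.symm, Fintype.sum_prod_type]
      simp only [Equiv.apply_symm_apply, mul_assoc]
    rw [dotProduct, Fintype.sum_prod_type]
    simp only [h1, Pi.star_apply]
    simp only [mulVec, dotProduct, g, Finset.mul_sum]
    calc _ = ∑ s, ∑ y, ∑ r, ∑ z, B l i.1 y * (star (ψ (s, r)) * (C z (s, i.2) *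
          ψ (e.symm (y, z), r))) := by
          refine Finset.sum_congr rfl fun s _ => ?_
          rw [Finset.sum_comm]
          refine Finset.sum_congr rfl fun y _ => Finset.sum_congr rfl fun r _ =>
            Finset.sum_congr rfl fun z _ => ?_
          ring
      _ = _ := Finset.sum_comm
  have hsum : ∑ i, ∑ l, ‖star ψ ⬝ᵥ
      (((discardKraus e C i * K l) ⊗ₖ (1 : Matrix R R ℂ)) *ᵥ ψ)‖ ^ 2 =
      ∑ i : X × Z, ‖g i.2 i.1‖ ^ 2 := by
    simp only [hg, Fintype.sum_prod_type]
    rw [Finset.sum_comm]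
    conv_rhs => rw [Finset.sum_comm]
    refine Finset.sum_congr rfl fun t _ => ?_
    rw [← hB.sum_norm_sq_mulVec (g t), Finset.sum_comm]
  have htr : (Ψ * C * Θᴴ).trace = ∑ i : X × Z, star (χ (e.symm i)) * g i.2 i.1 := by
    simp only [trace, diag_apply, Fintype.sum_prod_type]
    refine Finset.sum_congr rfl fun x _ => ?_
    calc _ = ∑ r, ∑ t, ∑ s, ∑ z, star (χ (e.symm (x, t))) * (star (ψ (s, r)) * (C z (s, t) *
          ψ (e.symm (x, z), r))) := by
          refine Finset.sum_congr rfl fun r _ => ?_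
          rw [mul_apply, Fintype.sum_prod_type, Finset.sum_comm]
          refine Finset.sum_congr rfl fun t _ => Finset.sum_congr rfl fun s _ => ?_
          rw [mul_apply, Finset.sum_mul]
          refine Finset.sum_congr rfl fun z _ => ?_
          rw [conjTranspose_apply]
          simp only [Θ, Ψ, star_mul']
          ring
      _ = _ := by
          rw [Finset.sum_comm]
          refine Finset.sum_congr rfl fun t _ => ?_
          rw [Finset.sum_comm]
          simp only [g, Finset.mul_sum]
  rw [hsum]
  have hCS : ‖(Ψ * C * Θᴴ).trace‖ ^ 2 ≤ ∑ i : X × Z, ‖g i.2 i.1‖ ^ 2 := by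
    rw [htr]
    have hχ1 : ∑ i, ‖χ (e.symm i)‖ ^ 2 = 1 := by
      rw [Equiv.sum_comp e.symm (fun s => ‖χ s‖ ^ 2)]
      exact sum_norm_sq_eq_one hχ
    calc ‖∑ i : X × Z, star (χ (e.symm i)) * g i.2 i.1‖ ^ 2
        ≤ (∑ i : X × Z, ‖χ (e.symm i)‖ * ‖g i.2 i.1‖) ^ 2 := by
          gcongr
          refine (norm_sum_le _ _).trans (le_of_eq ?_)
          simp
      _ ≤ (∑ i, ‖χ (e.symm i)‖ ^ 2) * ∑ i : X × Z, ‖g i.2 i.1‖ ^ 2 :=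
          Finset.sum_mul_sq_le_sq_mul_sq _ _ _
      _ = _ := by rw [hχ1, one_mul]
  refine le_trans (le_of_eq ?_) (hover.trans hCS)
  congr 3
  · simp
  · simp only [Matrix.sub_apply, hΨΨ, hΘΘ, Fintype.sum_prod_type]
    refine Finset.sum_congr rfl fun x _ => ?_
    rw [Finset.sum_comm]

end Recovery

/-! ### From Knill-Laflamme conditions to decoupling. -/

section CodeEstimate

variable {S X Z R ι : Type*} [Fintype ι]

lemma sum_mul_star_of_eq_sum {T : Type*} [Fintype T] {ψ : S × R → ℂ} {c : ι → R → ℂ}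
    {v : ι → S → ℂ} (h : ∀ s r, ψ (s, r) = ∑ i, c i r * v i s) (f g : T → S) (r r' : R) :
    ∑ t, ψ (f t, r) * star (ψ (g t, r')) =
      ∑ i, ∑ j, c i r * star (c j r') * ∑ t, v i (f t) * star (v j (g t)) := by
  calc _ = ∑ t, ∑ i, ∑ j, c i r * star (c j r') * (v i (f t) * star (v j (g t))) := by
        refine Finset.sum_congr rfl fun t _ => ?_
        rw [h, h, star_sum, Finset.sum_mul_sum]
        refine Finset.sum_congr rfl fun i _ => Finset.sum_congr rfl fun j _ => ?_
        rw [star_mul']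
        ring
    _ = _ := by
        rw [Finset.sum_comm]
        refine Finset.sum_congr rfl fun i _ => ?_
        rw [Finset.sum_comm]
        simp only [Finset.mul_sum]

/-- Cauchy-Schwarz over the pairs (i, j); the weights ‖c i r‖² ‖c j r'‖² sum to 1 over all indices.
-/
lemma sum_norm_sq_bilinear_le [Fintype R] (c : ι → R → ℂ) (hc : ∑ i, ∑ r, ‖c i r‖ ^ 2 = 1)
    (G : ι → ι → ℂ) :
    ∑ r, ∑ r', ‖∑ i, ∑ j, c i r * star (c j r') * G i j‖ ^ 2 ≤ ∑ i, ∑ j, ‖G i j‖ ^ 2 := by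
  have h1 : ∀ r r', ‖∑ i, ∑ j, c i r * star (c j r') * G i j‖ ^ 2 ≤
      ((∑ i, ‖c i r‖ ^ 2) * ∑ j, ‖c j r'‖ ^ 2) * ∑ i, ∑ j, ‖G i j‖ ^ 2 := by
    intro r r'
    have h2 : (∑ i, ‖c i r‖ ^ 2) * ∑ j, ‖c j r'‖ ^ 2 =
        ∑ p : ι × ι, (‖c p.1 r‖ * ‖c p.2 r'‖) ^ 2 := by
      rw [Finset.sum_mul_sum, Fintype.sum_prod_type]
      simp only [mul_pow]
    rw [h2, ← Fintype.sum_prod_type' (fun i j => ‖G i j‖ ^ 2),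
      ← Fintype.sum_prod_type' (fun i j => c i r * star (c j r') * G i j)]
    refine le_trans ?_ (Finset.sum_mul_sq_le_sq_mul_sq _ _ _)
    gcongr
    refine (norm_sum_le _ _).trans (le_of_eq ?_)
    simp
  refine (Finset.sum_le_sum fun r _ => Finset.sum_le_sum fun r' _ => h1 r r').trans ?_
  simp only [← Finset.sum_mul, ← Finset.mul_sum]
  rw [Finset.sum_comm] at hc
  rw [hc]
  simp

/-- The comparison value `A` need not come from a state, while decoupling requires a genuine reduced
state. Replacing `A` by the value `M i₀ i₀` of one code vector costs 2 + 2 card ι ≤ 4 card ι. -/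
lemma sum_norm_sq_sub_diag_le [DecidableEq ι] (M : ι → ι → ℂ) (i₀ : ι) (A : ℂ) :
    ∑ i, ∑ j, ‖M i j - if i = j then M i₀ i₀ else 0‖ ^ 2 ≤
      4 * Fintype.card ι * ∑ i, ∑ j, ‖M i j - if i = j then A else 0‖ ^ 2 := by
  set Y := ∑ i, ∑ j, ‖M i j - if i = j then A else 0‖ ^ 2 with hY
  have h0 : ‖M i₀ i₀ - A‖ ^ 2 ≤ Y := by
    have h1 : ‖M i₀ i₀ - A‖ ^ 2 ≤ ∑ j, ‖M i₀ j - if i₀ = j then A else 0‖ ^ 2 := by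
      have := Finset.single_le_sum (f := fun j => ‖M i₀ j - if i₀ = j then A else 0‖ ^ 2)
        (fun j _ => by positivity) (Finset.mem_univ i₀)
      simpa using this
    exact h1.trans (Finset.single_le_sum
      (f := fun i => ∑ j, ‖M i j - if i = j then A else 0‖ ^ 2)
        (fun j _ => by positivity) (Finset.mem_univ i₀))
  have hpt : ∀ i j, ‖M i j - if i = j then M i₀ i₀ else 0‖ ^ 2 ≤
      2 * ‖M i j - if i = j then A else 0‖ ^ 2 + if i = j then 2 * ‖M i₀ i₀ - A‖ ^ 2 else 0 := by
    intro i j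
    split_ifs
    · have h1 : ‖M i j - M i₀ i₀‖ ≤ ‖M i j - A‖ + ‖M i₀ i₀ - A‖ := by
        rw [norm_sub_rev (M i₀ i₀)]
        exact norm_sub_le_norm_sub_add_norm_sub _ _ _
      nlinarith [norm_nonneg (M i j - M i₀ i₀), sq_nonneg (‖M i j - A‖ - ‖M i₀ i₀ - A‖)]
    · nlinarith [sq_nonneg ‖M i j - 0‖]
  have hcard : (1 : ℝ) ≤ Fintype.card ι := by
    exact_mod_cast Fintype.card_pos_iff.mpr ⟨i₀⟩
  have hY0 : 0 ≤ Y := by positivity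
  calc _ ≤ ∑ i, ∑ j, (2 * ‖M i j - if i = j then A else 0‖ ^ 2 +
        if i = j then 2 * ‖M i₀ i₀ - A‖ ^ 2 else 0) :=
        Finset.sum_le_sum fun i _ => Finset.sum_le_sum fun j _ => hpt i j
    _ = 2 * Y + Fintype.card ι * (2 * ‖M i₀ i₀ - A‖ ^ 2) := by
        simp [Finset.sum_add_distrib, Finset.mul_sum, hY]
    _ ≤ 2 * Y + Fintype.card ι * (2 * Y) := by gcongr
    _ ≤ _ := by nlinarith

variable [Fintype S] [Fintype X] [Fintype Z] [Fintype R]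

/-- Deviation from decoupling in a code with orthonormal basis `v`. -/
lemma decoupling_error_le [DecidableEq ι] (e : S ≃ X × Z) (v : ι → S → ℂ)
    (hv : ∀ i j, star (v i) ⬝ᵥ v j = if i = j then 1 else 0) (i₀ : ι) (ψ : S × R → ℂ)
    (hψ : star ψ ⬝ᵥ ψ = 1) (hmem : ∀ r, (fun s => ψ (s, r)) ∈ Submodule.span ℂ (Set.range v))
    (A : X → X → ℂ) :
    ∑ x, ∑ y, ∑ r, ∑ r', ‖∑ z, ψ (e.symm (x, z), r) * star (ψ (e.symm (y, z), r')) -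
        (∑ z, v i₀ (e.symm (x, z)) * star (v i₀ (e.symm (y, z)))) *
          ∑ s, ψ (s, r) * star (ψ (s, r'))‖ ^ 2 ≤
      4 * Fintype.card ι * ∑ x, ∑ y, ∑ i, ∑ j,
        ‖∑ z, v i (e.symm (x, z)) * star (v j (e.symm (y, z))) -
          if i = j then A x y else 0‖ ^ 2 := by
  have hex : ∀ r, ∃ c : ι → ℂ, ∑ i, c i • v i = fun s => ψ (s, r) := fun r =>
    (Submodule.mem_span_range_iff_exists_fun ℂ).mp (hmem r)
  choose c' hc' using hex
  let c : ι → R → ℂ := fun i r => c' r i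
  have hψc : ∀ s r, ψ (s, r) = ∑ i, c i r * v i s := by
    intro s r
    have := congrFun (hc' r) s
    simpa [Finset.sum_apply, c] using this.symm
  have hv' : ∀ i j, ∑ s, v i s * star (v j s) = if i = j then 1 else 0 := by
    intro i j
    have := hv j i
    rw [dotProduct] at this
    simp only [Pi.star_apply, mul_comm (star _)] at this
    rw [this]
    exact if_congr eq_comm rfl rfl
  have hred : ∀ r r', ∑ s, ψ (s, r) * star (ψ (s, r')) = ∑ i, c i r * star (c i r') := by
    intro r r'
    have := sum_mul_star_of_eq_sum hψc id id r r'
    simp only [id] at this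
    rw [this]
    simp only [hv', mul_ite, mul_one, mul_zero, Finset.sum_ite_eq, Finset.mem_univ, if_true]
  have hcnorm : ∑ i, ∑ r, ‖c i r‖ ^ 2 = 1 := by
    have h1 : ∑ r, ∑ s, ψ (s, r) * star (ψ (s, r)) = 1 := by
      rw [← hψ, Finset.sum_comm, dotProduct, Fintype.sum_prod_type]
      exact Finset.sum_congr rfl fun i _ => Finset.sum_congr rfl fun j _ => mul_comm _ _
    simp only [hred] at h1
    simp only [RCLike.star_def, Complex.mul_conj, Complex.normSq_eq_norm_sq] at h1
    rw [Finset.sum_comm]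
    exact_mod_cast h1
  rw [Finset.mul_sum]
  refine Finset.sum_le_sum fun x _ => ?_
  rw [Finset.mul_sum]
  refine Finset.sum_le_sum fun y _ => ?_
  set M : ι → ι → ℂ := fun i j => ∑ z, v i (e.symm (x, z)) * star (v j (e.symm (y, z))) with hM
  refine le_trans ?_ (sum_norm_sq_sub_diag_le M i₀ (A x y))
  refine le_trans (le_of_eq ?_) (sum_norm_sq_bilinear_le c hcnorm _)
  refine Finset.sum_congr rfl fun r _ => Finset.sum_congr rfl fun r' _ => ?_
  rw [sum_mul_star_of_eq_sum hψc (fun z => e.symm (x, z)) (fun z => e.symm (y, z)), hred]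
  congr 2
  simp only [mul_sub, Finset.sum_sub_distrib, mul_ite, mul_zero, Finset.sum_ite_eq,
    Finset.mem_univ, if_true]
  rw [← Finset.sum_mul, mul_comm (M i₀ i₀)]

end CodeEstimate

/-! ### Errors on windows of qubits. -/

section LocalOperators

variable {N : ℕ}

/-- The operator `B ⊗ 1` for an operator `B` on the qubits in `W`. -/
def embed (W : Finset (Fin N)) (B : Matrix (W → Fin 2) (W → Fin 2) ℂ) : Op N :=
  fun x y => if ∀ q, q ∉ W → x q = y q then B (fun q => x q) (fun q => y q) else 0

/-- Configurations of all qubits as pairs of configurations in and outside `W`. -/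
def splitConf (W : Finset (Fin N)) : Conf N ≃ (W → Fin 2) × ({q // q ∉ W} → Fin 2) :=
  Equiv.piEquivPiSubtypeProd (fun q => q ∈ W) (fun _ => Fin 2)

lemma embed_apply (W : Finset (Fin N)) (B : Matrix (W → Fin 2) (W → Fin 2) ℂ) (s s' : Conf N) :
    embed W B s s' = if (splitConf W s).2 = (splitConf W s').2 then
      B (splitConf W s).1 (splitConf W s').1 else 0 := by
  have : (∀ q, q ∉ W → s q = s' q) ↔ (splitConf W s).2 = (splitConf W s').2 := by
    constructor
    · intro h
      ext q
      exact congrArg Fin.val (h q q.2)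
    · intro h q hq
      exact congrFun h ⟨q, hq⟩
  simp only [embed, this]
  rfl

lemma supportedOn_embed (W : Finset (Fin N)) (B : Matrix (W → Fin 2) (W → Fin 2) ℂ) :
    SupportedOn W (embed W B) :=
  ⟨B, fun _ _ => rfl⟩

/-- Trace preservation on `W` is read off from the entries whose configuration outside `W` is one
fixed `z`. -/
lemma isChannel_of_isChannel_embed (W : Finset (Fin N)) {m : ℕ}
    {B : Fin m → Matrix (W → Fin 2) (W → Fin 2) ℂ} (h : IsChannel fun l => embed W (B l)) :
    IsChannel B := by
  rw [IsChannel] at h ⊢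
  ext x y
  let z : {q // q ∉ W} → Fin 2 := fun _ => 0
  have h1 := congrFun (congrFun h ((splitConf W).symm (x, z))) ((splitConf W).symm (y, z))
  simp only [Matrix.sum_apply, mul_apply, conjTranspose_apply, embed_apply,
    Equiv.apply_symm_apply] at h1 ⊢
  have h2 : (1 : Op N) ((splitConf W).symm (x, z)) ((splitConf W).symm (y, z)) =
      (1 : Matrix (W → Fin 2) (W → Fin 2) ℂ) x y := by
    rw [one_apply, one_apply]
    simp
  rw [← h2, ← h1]
  refine Finset.sum_congr rfl fun l _ => ?_
  rw [← Equiv.sum_comp (splitConf W).symm (fun s => star _ * _), Fintype.sum_prod_type]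
  refine Finset.sum_congr rfl fun x' _ => ?_
  rw [Finset.sum_eq_single z]
  · simp
  · intro z' _ hz'
    simp [hz']
  · simp

/-- The bridge between the two languages: the left side is what ETH controls, the right side is an
entry of the partial trace of |v_i⟩⟨v_j| over the complement of `W`. -/
lemma conj_embed_single (W : Finset (Fin N)) (V : Op N) (x y : W → Fin 2) (i j : Conf N) :
    (Vᴴ * embed W (Matrix.single y x 1) * V) j i =
      ∑ z, V ((splitConf W).symm (x, z)) i * star (V ((splitConf W).symm (y, z)) j) := by
  have h1 : ∀ s, (Vᴴ * embed W (Matrix.single y x 1)) j s =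
      if (splitConf W s).1 = x then star (V ((splitConf W).symm (y, (splitConf W s).2)) j)
        else 0 := by
    intro s
    rw [mul_apply, ← Equiv.sum_comp (splitConf W).symm, Fintype.sum_prod_type,
      Finset.sum_eq_single y, Finset.sum_eq_single (splitConf W s).2]
    · simp [embed_apply, Matrix.single_apply, eq_comm]
    · intro z _ hz
      simp [embed_apply, hz]
    · simp
    · intro x' _ hx'
      refine Finset.sum_eq_zero fun z _ => ?_
      simp [embed_apply, Ne.symm hx']
    · simp
  rw [mul_apply, ← Equiv.sum_comp (splitConf W).symm, Fintype.sum_prod_type,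
    Finset.sum_eq_single x]
  · refine Finset.sum_congr rfl fun z _ => ?_
    rw [h1]
    simp [mul_comm]
  · intro x' _ hx'
    refine Finset.sum_eq_zero fun z _ => ?_
    rw [h1]
    simp [hx']
  · simp

lemma card_window_le (N d a : ℕ) : (window N d a).card ≤ d := by
  have h : (window N d a).card ≤ (Finset.Ico a (a + d)).card := by
    refine Finset.card_le_card_of_injOn (fun q => (q : ℕ)) ?_ ?_
    · intro q hq
      simpa [window] using hq
    · exact Fin.val_injective.injOn
  simpa using h

/-- These windows are empty, so only `N + 1` values of `a` matter in the union bound. -/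
lemma window_eq_of_le {N a : ℕ} (d : ℕ) (h : N ≤ a) : window N d a = window N d N := by
  ext q
  simp only [window, Finset.mem_filter, Finset.mem_univ, true_and]
  have := q.2
  omega

/-- The squared deviation, in all matrix elements of matrix units of the qubits in `W` between the
columns `s r` of `V`, from multiples `A` of the identity. -/
noncomputable def knillLaflammeError {K : ℕ} (W : Finset (Fin N)) (V : Op N) (s : Fin K → Conf N)
    (A : (W → Fin 2) → (W → Fin 2) → ℂ) : ℝ :=
  ∑ x, ∑ y, ∑ r, ∑ r', ‖(Vᴴ * embed W (Matrix.single x y 1) * V) (s r) (s r') -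
    if r = r' then A x y else 0‖ ^ 2

lemma star_column_dotProduct {K : ℕ} {V : Op N} (hV : V ∈ Matrix.unitaryGroup (Conf N) ℂ)
    (s : Fin K ↪ Conf N) (r r' : Fin K) :
    star (fun x => V x (s r)) ⬝ᵥ (fun x => V x (s r')) = if r = r' then 1 else 0 := by
  have h := congrFun (congrFun ((Matrix.mem_unitaryGroup_iff').mp hV) (s r)) (s r')
  rw [star_eq_conjTranspose, mul_apply, one_apply] at h
  simpa [s.injective.eq_iff, dotProduct] using h

lemma finrank_span_columns {K : ℕ} {V : Op N} (hV : V ∈ Matrix.unitaryGroup (Conf N) ℂ)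
    (s : Fin K ↪ Conf N) :
    Module.finrank ℂ (Submodule.span ℂ (Set.range fun r x => V x (s r))) = K := by
  have hli : LinearIndependent ℂ (fun (r : Fin K) (x : Conf N) => V x (s r)) := by
    rw [Fintype.linearIndependent_iff]
    intro g hg r
    have h := congrArg (fun u => star (fun x => V x (s r)) ⬝ᵥ u) hg
    simp only [dotProduct_sum, dotProduct_smul, star_column_dotProduct hV, dotProduct_zero] at h
    simpa using h
  simpa using finrank_span_eq_card hli

lemma decoupling_error_le_knillLaflammeError {K : ℕ} {R : Type*} [Fintype R] (W : Finset (Fin N))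
    {V : Op N} (hV : V ∈ Matrix.unitaryGroup (Conf N) ℂ) (s : Fin K ↪ Conf N) (i₀ : Fin K)
    (ψ : Conf N × R → ℂ) (hψ : star ψ ⬝ᵥ ψ = 1)
    (hmem : ∀ r, (fun x => ψ (x, r)) ∈ Submodule.span ℂ (Set.range fun r x => V x (s r)))
    (A : (W → Fin 2) → (W → Fin 2) → ℂ) :
    ∑ x, ∑ y, ∑ r, ∑ r', ‖∑ z, ψ ((splitConf W).symm (x, z), r) *
          star (ψ ((splitConf W).symm (y, z), r')) -
        (∑ z, V ((splitConf W).symm (x, z)) (s i₀) * star (V ((splitConf W).symm (y, z)) (s i₀))) *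
          ∑ x, ψ (x, r) * star (ψ (x, r'))‖ ^ 2 ≤
      4 * K * knillLaflammeError W V s A := by
  have herr := decoupling_error_le (splitConf W) (fun r x => V x (s r))
    (star_column_dotProduct hV s) i₀ ψ hψ hmem (fun x y => A y x)
  have hKL : ∑ x, ∑ y, ∑ i, ∑ j, ‖∑ z, V ((splitConf W).symm (x, z)) (s i) *
      star (V ((splitConf W).symm (y, z)) (s j)) - if i = j then A y x else 0‖ ^ 2 =
      knillLaflammeError W V s A := by
    rw [knillLaflammeError, Finset.sum_comm]
    refine Finset.sum_congr rfl fun y _ => Finset.sum_congr rfl fun x _ => ?_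
    rw [Finset.sum_comm]
    refine Finset.sum_congr rfl fun j _ => Finset.sum_congr rfl fun i _ => ?_
    rw [conj_embed_single]
    congr 3
    exact if_congr eq_comm rfl rfl
  rw [hKL, Fintype.card_fin] at herr
  exact herr

lemma exists_decoder_of_knillLaflammeError {K : ℕ} {R : Type*} [Fintype R] [DecidableEq R]
    (W : Finset (Fin N)) {V : Op N} (hV : V ∈ Matrix.unitaryGroup (Conf N) ℂ)
    (s : Fin K ↪ Conf N) (i₀ : Fin K) (ψ : Conf N × R → ℂ) (hψ : star ψ ⬝ᵥ ψ = 1)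
    (hmem : ∀ r, (fun x => ψ (x, r)) ∈ Submodule.span ℂ (Set.range fun r x => V x (s r)))
    (A : (W → Fin 2) → (W → Fin 2) → ℂ) {m : ℕ} {L : Fin m → Op N} (hL : IsChannel L)
    (hsupp : ∀ l, SupportedOn W (L l)) :
    ∃ (m' : ℕ) (D : Fin m' → Op N), IsChannel D ∧
      1 - √(2 ^ W.card * Fintype.card R * (4 * K * knillLaflammeError W V s A)) ≤
        recoveryFidelity D L ψ := by
  choose B hB using hsupp
  have hLB : L = fun l => embed W (B l) := by
    funext l
    ext x y
    exact hB l x y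
  subst hLB
  have hBch : IsChannel B := isChannel_of_isChannel_embed W hL
  obtain ⟨m', D, hD, hfid⟩ := exists_decoder_of_decoupled (splitConf W) ψ hψ
    (fun x => V x (s i₀)) (by rw [star_column_dotProduct hV s]; simp) hBch
    (K := fun l => embed W (B l)) (fun l x y => embed_apply W (B l) x y)
  refine ⟨m', D, hD, le_trans ?_ hfid⟩
  refine sub_le_sub_left (Real.sqrt_le_sqrt ?_) 1
  have hcard : (Fintype.card (W → Fin 2) : ℝ) = 2 ^ W.card := by simp
  rw [hcard]
  exact mul_le_mul_of_nonneg_left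
    (decoupling_error_le_knillLaflammeError W hV s i₀ ψ hψ hmem A) (by positivity)

/-- Code and reference both have dimension 2^k, whence the factor (2^k)². The constants `A` may
differ between windows. -/
theorem isAQECC_of_knillLaflammeError_le {k d : ℕ} {V : Op N}
    (hV : V ∈ Matrix.unitaryGroup (Conf N) ℂ) (s : Fin (2 ^ k) ↪ Conf N) {Y : ℝ}
    (hY : ∀ a, ∃ A, knillLaflammeError (window N d a) V s A ≤ Y) :
    IsAQECC k d (√(4 * 2 ^ d * (2 ^ k) ^ 2 * Y))
      (Submodule.span ℂ (Set.range fun r x => V x (s r))) := by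
  refine ⟨finrank_span_columns hV s, ?_⟩
  intro a m L hL hsupp ψ hmem hψ
  obtain ⟨A, hA⟩ := hY a
  obtain ⟨m', D, hD, hfid⟩ := exists_decoder_of_knillLaflammeError (window N d a) hV s
    ⟨0, by positivity⟩ ψ hψ hmem A hL hsupp
  refine ⟨m', D, hD, le_trans ?_ hfid⟩
  refine sub_le_sub_left (Real.sqrt_le_sqrt ?_) 1
  have hKL0 : 0 ≤ knillLaflammeError (window N d a) V s A := by
    unfold knillLaflammeError
    positivity
  have hcard : (2 : ℝ) ^ (window N d a).card ≤ 2 ^ d :=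
    pow_le_pow_right₀ (by norm_num) (card_window_le N d a)
  have hcardR : (Fintype.card (Fin (2 ^ k)) : ℝ) = 2 ^ k := by simp
  have hcast : ((2 ^ k : ℕ) : ℝ) = 2 ^ k := by push_cast; rfl
  rw [hcardR, hcast]
  calc _ ≤ (2 : ℝ) ^ d * 2 ^ k * (4 * 2 ^ k * Y) :=
        mul_le_mul (mul_le_mul_of_nonneg_right hcard (by positivity))
          (mul_le_mul_of_nonneg_left hA (by positivity)) (by positivity) (by positivity)
    _ = _ := by ring

lemma isAQECC_one {k d : ℕ} {C : Submodule ℂ (Conf N → ℂ)} (hC : Module.finrank ℂ C = 2 ^ k) :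
    IsAQECC k d 1 C := by
  refine ⟨hC, fun a m K _ _ ψ _ _ => ⟨1, fun _ => 1, by simp [IsChannel], ?_⟩⟩
  simpa using recoveryFidelity_nonneg _ K ψ

lemma codeError_le {k d : ℕ} {C : Submodule ℂ (Conf N → ℂ)} {ε : ℝ} (hε : 0 ≤ ε)
    (h : IsAQECC k d ε C) : codeError k d C ≤ ε :=
  csInf_le ⟨0, fun _ hx => hx.1⟩ ⟨hε, h⟩

end LocalOperators

/-! ### Matrix units as combinations of observables. -/

section MatrixUnits

variable {N : ℕ}

lemma embed_add (W : Finset (Fin N)) (B B' : Matrix (W → Fin 2) (W → Fin 2) ℂ) :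
    embed W (B + B') = embed W B + embed W B' := by
  ext x y
  simp only [embed_apply, Matrix.add_apply]
  split_ifs <;> simp

lemma embed_smul (W : Finset (Fin N)) (a : ℂ) (B : Matrix (W → Fin 2) (W → Fin 2) ℂ) :
    embed W (a • B) = a • embed W B := by
  ext x y
  simp only [embed_apply, Matrix.smul_apply]
  split_ifs <;> simp

lemma embed_conjTranspose (W : Finset (Fin N)) (B : Matrix (W → Fin 2) (W → Fin 2) ℂ) :
    (embed W B)ᴴ = embed W Bᴴ := by
  ext x y
  simp only [embed_apply, conjTranspose_apply, eq_comm (a := (splitConf W y).2)]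
  split_ifs <;> simp

lemma embed_single_mulVec (W : Finset (Fin N)) (x y : W → Fin 2) (v : Conf N → ℂ)
    (x' : W → Fin 2) (z : {q // q ∉ W} → Fin 2) :
    (embed W (Matrix.single x y 1) *ᵥ v) ((splitConf W).symm (x', z)) =
      if x = x' then v ((splitConf W).symm (y, z)) else 0 := by
  rw [mulVec, dotProduct, ← Equiv.sum_comp (splitConf W).symm, Fintype.sum_prod_type,
    Finset.sum_eq_single y, Finset.sum_eq_single z]
  · simp [embed_apply, Matrix.single_apply]
  · intro z' _ hz'
    simp [embed_apply, Ne.symm hz']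
  · simp
  · intro y' _ hy'
    refine Finset.sum_eq_zero fun z' _ => ?_
    simp [embed_apply, Ne.symm hy']
  · simp

lemma norm_embed_single_le_one (W : Finset (Fin N)) (x y : W → Fin 2) :
    ‖Matrix.toEuclideanCLM (𝕜 := ℂ) (embed W (Matrix.single x y 1))‖ ≤ 1 := by
  refine ContinuousLinearMap.opNorm_le_bound _ zero_le_one fun v => ?_
  rw [one_mul, EuclideanSpace.norm_eq, EuclideanSpace.norm_eq]
  refine Real.sqrt_le_sqrt ?_
  simp only [Matrix.ofLp_toEuclideanCLM]
  rw [← Equiv.sum_comp (splitConf W).symm, ← Equiv.sum_comp (splitConf W).symm (fun s => ‖v s‖ ^ 2),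
    Fintype.sum_prod_type, Fintype.sum_prod_type]
  simp only [embed_single_mulVec]
  rw [Finset.sum_eq_single x]
  · simp only [if_true]
    exact Finset.single_le_sum
      (f := fun x' => ∑ z, ‖v ((splitConf W).symm (x', z))‖ ^ 2)
      (fun _ _ => by positivity) (Finset.mem_univ y)
  · intro x' _ hx'
    simp [Ne.symm hx']
  · simp

/-- Matrix units are combinations of two normalized observables. -/
lemma exists_observables_matrixUnit (W : Finset (Fin N)) (x y : W → Fin 2) :
    ∃ A₁ A₂ : Op N, A₁.IsHermitian ∧ SupportedOn W A₁ ∧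
      ‖Matrix.toEuclideanCLM (𝕜 := ℂ) A₁‖ ≤ 1 ∧ A₂.IsHermitian ∧ SupportedOn W A₂ ∧
      ‖Matrix.toEuclideanCLM (𝕜 := ℂ) A₂‖ ≤ 1 ∧
      embed W (Matrix.single x y 1) = A₁ + (-Complex.I) • A₂ := by
  set E := embed W (Matrix.single x y (1 : ℂ)) with hE
  set E' := embed W (Matrix.single y x (1 : ℂ)) with hE'
  have hH : Eᴴ = E' := by rw [hE, embed_conjTranspose, conjTranspose_single, star_one]
  have hH' : E'ᴴ = E := by rw [← hH, conjTranspose_conjTranspose]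
  have hn : ‖Matrix.toEuclideanCLM (𝕜 := ℂ) E‖ ≤ 1 := norm_embed_single_le_one W x y
  have hn' : ‖Matrix.toEuclideanCLM (𝕜 := ℂ) E'‖ ≤ 1 := norm_embed_single_le_one W y x
  have hnorm : ∀ a b : ℂ, ‖a‖ = 1 / 2 → ‖b‖ = 1 / 2 →
      ‖Matrix.toEuclideanCLM (𝕜 := ℂ) (a • E + b • E')‖ ≤ 1 := by
    intro a b ha hb
    rw [map_add, map_smul, map_smul]
    refine (norm_add_le _ _).trans ?_
    rw [norm_smul, norm_smul, ha, hb]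
    linarith
  have hsupp : ∀ a b : ℂ, SupportedOn W (a • E + b • E') := by
    intro a b
    rw [hE, hE', ← embed_smul, ← embed_smul, ← embed_add]
    exact supportedOn_embed _ _
  -- Real and imaginary parts: A₁ = (E + Eᴴ)/2 and A₂ = i(E - Eᴴ)/2, so that A₁ - iA₂ = E.
  refine ⟨(1 / 2 : ℂ) • E + (1 / 2 : ℂ) • E', (Complex.I / 2) • E + (-(Complex.I / 2)) • E',
    ?_, hsupp _ _, hnorm _ _ (by simp) (by simp), ?_, hsupp _ _, hnorm _ _ (by simp) (by simp), ?_⟩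
  · rw [Matrix.IsHermitian, conjTranspose_add, conjTranspose_smul, conjTranspose_smul, hH, hH',
      add_comm]
    simp
  · rw [Matrix.IsHermitian, conjTranspose_add, conjTranspose_smul, conjTranspose_smul, hH, hH',
      add_comm, star_neg, RCLike.star_def, map_div₀, Complex.conj_I, Complex.conj_ofNat, neg_div,
      neg_neg]
  · rw [smul_add, smul_smul, smul_smul]
    have h1 : -Complex.I * (Complex.I / 2) = 1 / 2 := by
      linear_combination (-1 / 2 : ℂ) * Complex.I_mul_I
    have h2 : -Complex.I * -(Complex.I / 2) = -(1 / 2) := by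
      linear_combination (1 / 2 : ℂ) * Complex.I_mul_I
    rw [h1, h2]
    module

end MatrixUnits

/-! ### Moments under ETH and the high-probability bound. -/

namespace Ensemble

variable {N : ℕ} {Ω : Type*} [MeasurableSpace Ω] {Q : Ensemble N Ω} {P : Measure Ω} {d : ℕ}
  {E₀ Δ β c : ℝ}

lemma measurable_matrixElement (A : Op N) (i j : Conf N) : Measurable (Q.matrixElement A i j) := by
  unfold matrixElement
  simp only [mul_apply, conjTranspose_apply]
  refine Finset.measurable_sum _ fun y _ => Measurable.mul (Finset.measurable_sum _ fun x _ => ?_)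
    (Q.measurable y j)
  exact (continuous_star.measurable.comp (Q.measurable x i)).mul_const _

/-- The second moments of the fluctuations of the matrix elements of a local observable. -/
lemma SatisfiesETH.second_moment_le (hβ : 0 < β) (h : Q.SatisfiesETH P d E₀ Δ β c) {A : Op N}
    (hA : IsLocalObservable d A) (hA1 : ‖Matrix.toEuclideanCLM (𝕜 := ℂ) A‖ ≤ 1) :
    ∃ a : ℂ, ∀ i ∈ Q.shell E₀ Δ, ∀ j ∈ Q.shell E₀ Δ,
      Integrable (fun o => ‖Q.matrixElement A i j o - if i = j then a else 0‖ ^ 2) P ∧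
      ∫ o, ‖Q.matrixElement A i j o - if i = j then a else 0‖ ^ 2 ∂P ≤
        c ^ 2 * Real.exp (-Q.entropy E₀ Δ) := by
  obtain ⟨Abar, f, R, -, -, hf, hR⟩ := h A hA hA1
  refine ⟨Abar E₀, fun i hi j hj => ?_⟩
  obtain ⟨hL2, -, hvar, hae⟩ := hR i hi j hj
  set b : ℝ := Real.exp (-(Q.entropy E₀ Δ) / 2) * f (E₀, Q.E i - Q.E j) with hb
  have hae' : (fun o => ‖Q.matrixElement A i j o - if i = j then (Abar E₀ : ℂ) else 0‖ ^ 2) =ᵐ[P]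
      fun o => b ^ 2 * ‖R i j o‖ ^ 2 := by
    filter_upwards [hae] with o ho
    rw [ho, add_sub_cancel_left, norm_mul, mul_pow, Complex.norm_real, Real.norm_eq_abs, sq_abs]
  have hInt : Integrable (fun o => b ^ 2 * ‖R i j o‖ ^ 2) P :=
    (hL2.norm.integrable_sq).const_mul _
  refine ⟨hInt.congr hae'.symm, ?_⟩
  rw [integral_congr_ae hae', integral_const_mul, hvar, mul_one, hb, mul_pow, ← Real.exp_nat_mul]
  have hfc : f (E₀, Q.E i - Q.E j) ^ 2 ≤ c ^ 2 := by
    have h1 := hf (Q.E i - Q.E j)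
    have hexp : Real.exp (-(β / 4) * |Q.E i - Q.E j|) ≤ 1 := by
      rw [Real.exp_le_one_iff]
      have : 0 ≤ β / 4 * |Q.E i - Q.E j| := by positivity
      linarith
    have hc : 0 ≤ c := by
      by_contra hc
      have := Real.exp_pos (-(β / 4) * |Q.E i - Q.E j|)
      nlinarith [abs_nonneg (f (E₀, Q.E i - Q.E j))]
    rw [← sq_abs]
    refine pow_le_pow_left₀ (abs_nonneg _) (h1.trans ?_) 2
    nlinarith
  have he : ((2 : ℕ) : ℝ) * (-Q.entropy E₀ Δ / 2) = -Q.entropy E₀ Δ := by push_cast; ring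
  rw [he, mul_comm]
  exact mul_le_mul_of_nonneg_right hfc (Real.exp_pos _).le

/-- ETH concerns Hermitian operators only, so the unit is split into two observables; |X₁ - iX₂|² ≤
2|X₁|² + 2|X₂|² produces the 4. -/
lemma SatisfiesETH.matrixUnit_second_moment_le (hβ : 0 < β) (h : Q.SatisfiesETH P d E₀ Δ β c)
    (a : ℕ) (x y : window N d a → Fin 2) :
    ∃ b : ℂ, ∀ i ∈ Q.shell E₀ Δ, ∀ j ∈ Q.shell E₀ Δ,
      Integrable (fun o => ‖Q.matrixElement (embed _ (Matrix.single x y 1)) i j o -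
        if i = j then b else 0‖ ^ 2) P ∧
      ∫ o, ‖Q.matrixElement (embed _ (Matrix.single x y 1)) i j o -
        if i = j then b else 0‖ ^ 2 ∂P ≤ 4 * c ^ 2 * Real.exp (-Q.entropy E₀ Δ) := by
  obtain ⟨A₁, A₂, hH₁, hS₁, hn₁, hH₂, hS₂, hn₂, hE⟩ := exists_observables_matrixUnit _ x y
  obtain ⟨b₁, hb₁⟩ := h.second_moment_le hβ ⟨hH₁, a, hS₁⟩ hn₁
  obtain ⟨b₂, hb₂⟩ := h.second_moment_le hβ ⟨hH₂, a, hS₂⟩ hn₂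
  refine ⟨b₁ + (-Complex.I) * b₂, fun i hi j hj => ?_⟩
  obtain ⟨hi₁, hm₁⟩ := hb₁ i hi j hj
  obtain ⟨hi₂, hm₂⟩ := hb₂ i hi j hj
  set X₁ := fun o => Q.matrixElement A₁ i j o - if i = j then b₁ else 0 with hX₁
  set X₂ := fun o => Q.matrixElement A₂ i j o - if i = j then b₂ else 0 with hX₂
  have hpt : ∀ o, ‖Q.matrixElement (embed _ (Matrix.single x y 1)) i j o -
      if i = j then b₁ + (-Complex.I) * b₂ else 0‖ ^ 2 ≤ 2 * ‖X₁ o‖ ^ 2 + 2 * ‖X₂ o‖ ^ 2 := by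
    intro o
    have h1 : Q.matrixElement (embed _ (Matrix.single x y 1)) i j o -
        (if i = j then b₁ + (-Complex.I) * b₂ else 0) = X₁ o + (-Complex.I) * X₂ o := by
      have h2 : Q.matrixElement (embed _ (Matrix.single x y 1)) i j o =
          Q.matrixElement A₁ i j o + (-Complex.I) * Q.matrixElement A₂ i j o := by
        simp only [matrixElement, hE, Matrix.mul_add, Matrix.add_mul, Matrix.mul_smul,
          Matrix.smul_mul, Matrix.add_apply, Matrix.smul_apply, smul_eq_mul]
      rw [h2, hX₁, hX₂]
      split_ifs <;> ring
    rw [h1]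
    have h3 : ‖X₁ o + (-Complex.I) * X₂ o‖ ≤ ‖X₁ o‖ + ‖X₂ o‖ := by
      refine (norm_add_le _ _).trans (le_of_eq ?_)
      simp
    nlinarith [norm_nonneg (X₁ o + (-Complex.I) * X₂ o), sq_nonneg (‖X₁ o‖ - ‖X₂ o‖)]
  have hInt : Integrable (fun o => 2 * ‖X₁ o‖ ^ 2 + 2 * ‖X₂ o‖ ^ 2) P :=
    (hi₁.const_mul 2).add (hi₂.const_mul 2)
  have hmeas : Measurable fun o => ‖Q.matrixElement (embed _ (Matrix.single x y 1)) i j o -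
      if i = j then b₁ + (-Complex.I) * b₂ else 0‖ ^ 2 :=
    ((measurable_matrixElement _ i j).sub_const _).norm.pow_const 2
  have hInt' := hInt.mono' hmeas.aestronglyMeasurable (Eventually.of_forall fun o => by
    rw [Real.norm_of_nonneg (by positivity)]
    exact hpt o)
  refine ⟨hInt', (integral_mono hInt' hInt hpt).trans ?_⟩
  rw [integral_add (hi₁.const_mul 2) (hi₂.const_mul 2), integral_const_mul, integral_const_mul]
  linarith

lemma SatisfiesETH.knillLaflammeError_moment_le (hβ : 0 < β) (h : Q.SatisfiesETH P d E₀ Δ β c)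
    {K : ℕ} (s : Fin K ↪ Conf N) (hs : ∀ r, s r ∈ Q.shell E₀ Δ) (a : ℕ) :
    ∃ A, Integrable (fun o => knillLaflammeError (window N d a) (Q.V o) s A) P ∧
      ∫ o, knillLaflammeError (window N d a) (Q.V o) s A ∂P ≤
        (2 ^ d) ^ 2 * (K : ℝ) ^ 2 * (4 * c ^ 2 * Real.exp (-Q.entropy E₀ Δ)) := by
  choose A hA using fun x y => h.matrixUnit_second_moment_le hβ a x y
  have hA' : ∀ x y r r',
      Integrable (fun o => ‖((Q.V o)ᴴ * embed (window N d a) (Matrix.single x y 1) * Q.V o)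
        (s r) (s r') - if r = r' then A x y else 0‖ ^ 2) P ∧
      ∫ o, ‖((Q.V o)ᴴ * embed (window N d a) (Matrix.single x y 1) * Q.V o)
        (s r) (s r') - if r = r' then A x y else 0‖ ^ 2 ∂P ≤
          4 * c ^ 2 * Real.exp (-Q.entropy E₀ Δ) := by
    intro x y r r'
    have := hA x y (s r) (hs r) (s r') (hs r')
    simpa only [s.injective.eq_iff, matrixElement] using this
  refine ⟨A, ?_, ?_⟩
  · unfold knillLaflammeError
    exact integrable_finsetSum _ fun x _ => integrable_finsetSum _ fun y _ =>
      integrable_finsetSum _ fun r _ => integrable_finsetSum _ fun r' _ => (hA' x y r r').1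
  · unfold knillLaflammeError
    rw [integral_finsetSum _ fun x _ => integrable_finsetSum _ fun y _ =>
      integrable_finsetSum _ fun r _ => integrable_finsetSum _ fun r' _ => (hA' x y r r').1]
    have hsum : ∀ x, ∫ o, ∑ y, ∑ r, ∑ r',
        ‖((Q.V o)ᴴ * embed (window N d a) (Matrix.single x y 1) * Q.V o)
          (s r) (s r') - if r = r' then A x y else 0‖ ^ 2 ∂P ≤
        ∑ _y : (window N d a → Fin 2), ∑ _r : Fin K, ∑ _r' : Fin K,
          4 * c ^ 2 * Real.exp (-Q.entropy E₀ Δ) := by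
      intro x
      rw [integral_finsetSum _ fun y _ => integrable_finsetSum _ fun r _ =>
        integrable_finsetSum _ fun r' _ => (hA' x y r r').1]
      refine Finset.sum_le_sum fun y _ => ?_
      rw [integral_finsetSum _ fun r _ => integrable_finsetSum _ fun r' _ => (hA' x y r r').1]
      refine Finset.sum_le_sum fun r _ => ?_
      rw [integral_finsetSum _ fun r' _ => (hA' x y r r').1]
      exact Finset.sum_le_sum fun r' _ => (hA' x y r r').2
    refine (Finset.sum_le_sum fun x _ => hsum x).trans ?_
    simp only [Finset.sum_const, Finset.card_univ, nsmul_eq_mul, Fintype.card_fin]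
    have hcard : (Fintype.card (window N d a → Fin 2) : ℝ) ≤ 2 ^ d := by
      have h1 : (Fintype.card (window N d a → Fin 2) : ℝ) = 2 ^ (window N d a).card := by simp
      rw [h1]
      exact pow_le_pow_right₀ (by norm_num) (card_window_le N d a)
    have hcard2 := pow_le_pow_left₀ (Nat.cast_nonneg _) hcard 2
    calc _ = (Fintype.card (window N d a → Fin 2) : ℝ) ^ 2 * ((K : ℝ) ^ 2 *
          (4 * c ^ 2 * Real.exp (-Q.entropy E₀ Δ))) := by ring
      _ ≤ (2 ^ d) ^ 2 * ((K : ℝ) ^ 2 * (4 * c ^ 2 * Real.exp (-Q.entropy E₀ Δ))) :=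
          mul_le_mul_of_nonneg_right hcard2 (by positivity)
      _ = _ := by ring

/-- With high probability the error of a code spanned by eigenstates is exponentially small. -/
theorem SatisfiesETH.prob_codeError_le [IsProbabilityMeasure P] (hβ : 0 < β)
    (h : Q.SatisfiesETH P d E₀ Δ β c) {k : ℕ} (s : Fin (2 ^ k) ↪ Conf N)
    (hs : ∀ r, s r ∈ Q.shell E₀ Δ) :
    1 - ENNReal.ofReal (1 / (N + 1)) ≤ P {o | codeError k d (Q.codeSpace s o) ≤
      √(16 * 2 ^ (3 * d) * 2 ^ (4 * k) * (N + 1) ^ 2 * (|c| + 1) ^ 2 *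
        Real.exp (-Q.entropy E₀ Δ))} := by
  choose A hInt hmom using fun a => h.knillLaflammeError_moment_le hβ s hs a
  set X : Ω → ℝ := fun o => ∑ a ∈ Finset.range (N + 1),
    knillLaflammeError (window N d a) (Q.V o) s (A a) with hX
  have hKL0 : ∀ a o, 0 ≤ knillLaflammeError (window N d a) (Q.V o) s (A a) := by
    intro a o
    unfold knillLaflammeError
    positivity
  have hX0 : ∀ o, 0 ≤ X o := fun o => Finset.sum_nonneg fun a _ => hKL0 a o
  have hXint : Integrable X P := integrable_finsetSum _ fun a _ => hInt a
  -- `|c| + 1` in place of `c` keeps `M` strictly positive, so that Markov's inequality can be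
  -- divided by it.
  set M : ℝ := (2 ^ d) ^ 2 * (2 ^ k) ^ 2 * (4 * (|c| + 1) ^ 2 * Real.exp (-Q.entropy E₀ Δ)) with hM
  have hMpos : 0 < M := by positivity
  have hmom' : ∀ a, ∫ o, knillLaflammeError (window N d a) (Q.V o) s (A a) ∂P ≤ M := by
    intro a
    refine (hmom a).trans ?_
    have hc : c ^ 2 ≤ (|c| + 1) ^ 2 := by
      rw [← sq_abs]
      exact pow_le_pow_left₀ (abs_nonneg _) (by linarith) 2
    rw [hM]
    push_cast
    gcongr
  have hXM : ∫ o, X o ∂P ≤ (N + 1) * M := by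
    rw [hX, integral_finsetSum _ fun a _ => hInt a]
    refine (Finset.sum_le_sum fun a _ => hmom' a).trans (le_of_eq ?_)
    simp
  -- The mean is at most (N+1)M, so the threshold (N+1)²M leaves probability 1/(N+1).
  have hbad : P {o | (N + 1) ^ 2 * M ≤ X o} ≤ ENNReal.ofReal (1 / (N + 1)) := by
    have h1 := mul_meas_ge_le_integral_of_nonneg (Eventually.of_forall hX0) hXint
      ((N + 1) ^ 2 * M)
    have h2 : P.real {o | (N + 1) ^ 2 * M ≤ X o} ≤ 1 / (N + 1) := by
      have h3 := h1.trans hXM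
      rw [le_div_iff₀ (by positivity)]
      have h4 : (0 : ℝ) < (N + 1) * M := by positivity
      refine le_of_mul_le_mul_left ?_ h4
      calc _ = (N + 1) ^ 2 * M * P.real {o | (N + 1) ^ 2 * M ≤ X o} := by ring
        _ ≤ _ := by rw [mul_one]; exact h3
    rw [← ENNReal.ofReal_toReal (measure_ne_top P {o | (N + 1) ^ 2 * M ≤ X o})]
    exact ENNReal.ofReal_le_ofReal h2
  -- Subadditivity holds for arbitrary sets, so the event on `codeError` need not be shown
  -- measurable.
  rw [tsub_le_iff_right, ← measure_univ (μ := P)]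
  refine le_trans (measure_mono ?_) ((measure_union_le _ {o | (N + 1) ^ 2 * M ≤ X o}).trans
    (add_le_add_right hbad _))
  intro o _
  by_cases ho : (N + 1) ^ 2 * M ≤ X o
  · exact Or.inr ho
  left
  push Not at ho
  have hY : ∀ a, ∃ A, knillLaflammeError (window N d a) (Q.V o) s A ≤ (N + 1) ^ 2 * M := by
    have hlt : ∀ a ∈ Finset.range (N + 1), ∃ A,
        knillLaflammeError (window N d a) (Q.V o) s A ≤ (N + 1) ^ 2 * M := fun a ha =>
      ⟨A a, (Finset.single_le_sum (f := fun a => knillLaflammeError (window N d a) (Q.V o) s (A a))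
        (fun a _ => hKL0 a o) ha).trans ho.le⟩
    intro a
    rcases Nat.lt_or_ge a N with haN | haN
    · exact hlt a (by simp; omega)
    · rw [window_eq_of_le d haN]
      exact hlt N (by simp)
  refine codeError_le (Real.sqrt_nonneg _) ?_
  have := isAQECC_of_knillLaflammeError_le (Q.unitary o) s hY
  have hT : 4 * 2 ^ d * (2 ^ k) ^ 2 * ((N + 1) ^ 2 * M) = 16 * 2 ^ (3 * d) * 2 ^ (4 * k) *
      (N + 1) ^ 2 * (|c| + 1) ^ 2 * Real.exp (-Q.entropy E₀ Δ) := by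
    rw [hM, mul_comm 3 d, mul_comm 4 k, pow_mul, pow_mul]
    ring
  rw [hT] at this
  exact this

end Ensemble

/-! ### Subextensive corrections against the entropy. -/

section Asymptotic

lemma isLittleO_log_mul_add_one {a : ℝ} (ha : 0 < a) :
    (fun n : ℕ => Real.log (a * (n + 1))) =o[atTop] fun n : ℕ => (n : ℝ) := by
  have htop : Tendsto (fun n : ℕ => a * ((n : ℝ) + 1)) atTop atTop :=
    (tendsto_natCast_atTop_atTop.atTop_add tendsto_const_nhds).const_mul_atTop ha
  have h1 := Real.isLittleO_log_id_atTop.comp_tendsto htop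
  refine h1.trans_isBigO (IsBigO.of_bound (2 * a) ?_)
  filter_upwards [eventually_ge_atTop 1] with n hn
  have hn' : (1 : ℝ) ≤ n := by exact_mod_cast hn
  simp only [Function.comp, id]
  rw [Real.norm_of_nonneg (by positivity), Real.norm_of_nonneg (by positivity)]
  nlinarith

/-- Subextensive corrections are eventually dominated by an extensive entropy. -/
lemma eventually_subextensive_lt {N : ℕ → ℕ} (hN : Tendsto N atTop atTop) {Δ S : ℕ → ℝ}
    (hΔ : Δ =o[atTop] fun n => (N n : ℝ)) (hS : (fun n => (N n : ℝ)) =O[atTop] S)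
    (hS0 : ∀ n, 0 ≤ S n) (β : ℝ) {a : ℝ} (ha : 0 < a) :
    ∀ᶠ n in atTop, β * |Δ n| + 4 / 3 * Real.log (a * (N n + 1)) < S n / 6 := by
  have hlog : (fun n => Real.log (a * (N n + 1))) =o[atTop] fun n => (N n : ℝ) :=
    (isLittleO_log_mul_add_one ha).comp_tendsto hN
  have h : (fun n => β * |Δ n| + 4 / 3 * Real.log (a * (N n + 1))) =o[atTop] S :=
    ((hΔ.abs_left.const_mul_left β).add (hlog.const_mul_left (4 / 3))).trans_isBigO hS
  obtain ⟨C, hC, hbound⟩ := hS.exists_pos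
  -- N ≥ 1 and N = O(S) force S > 0, so the bound S/12 is strictly below S/6.
  filter_upwards [h.bound (by norm_num : (0 : ℝ) < 1 / 12), hbound.bound,
    hN.eventually_ge_atTop 1] with n h1 h2 h3
  rw [Real.norm_of_nonneg (hS0 n)] at h1 h2
  rw [Real.norm_of_nonneg (Nat.cast_nonneg _)] at h2
  have h4 : (1 : ℝ) ≤ N n := by exact_mod_cast h3
  have h5 : 0 < S n := by
    by_contra hneg
    nlinarith [hS0 n]
  have h6 := (le_abs_self _).trans h1
  linarith

/-- Split -2 ln ε = -(4/3) ln ε - (2/3) ln ε. The square-root bound is applied to the first term,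
where (4/3)(3d/2) = 2d cancels the d-dependence exactly; the second is nonnegative as ε ≤ 1. What
remains is 2S/3 - S/2 = S/6, a nonnegative multiple of k, and -(4/3) ln a. -/
lemma log_le_of_le_one_of_le_sqrt {ε a S : ℝ} {d k : ℕ} (hε : 0 < ε) (ha : 0 < a) (h1 : ε ≤ 1)
    (h : ε ≤ √(2 ^ (3 * d) * 2 ^ (4 * k) * a ^ 2 * Real.exp (-S))) :
    S / 6 - 4 / 3 * Real.log a ≤ 2 * Real.log (2 ^ (d + 2 * k) / ε) - S / 2 := by
  have hlog1 : Real.log ε ≤ 0 := Real.log_nonpos hε.le h1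
  have hlog : Real.log ε ≤ (3 * d * Real.log 2 + 4 * k * Real.log 2 + 2 * Real.log a - S) / 2 := by
    refine (Real.log_le_log hε h).trans (le_of_eq ?_)
    rw [Real.log_sqrt (by positivity), Real.log_mul (by positivity) (by positivity),
      Real.log_mul (by positivity) (by positivity), Real.log_mul (by positivity) (by positivity),
      Real.log_exp, Real.log_pow, Real.log_pow, Real.log_pow]
    push_cast
    ring
  rw [Real.log_div (by positivity) hε.ne', Real.log_pow]
  push_cast
  have hk : 0 ≤ (k : ℝ) * Real.log 2 :=
    mul_nonneg (Nat.cast_nonneg _) (Real.log_nonneg (by norm_num))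
  nlinarith

end Asymptotic

/-! ### Elementary bounds on the shell and the code error. -/

namespace Ensemble

variable {N : ℕ} {Ω : Type*} [MeasurableSpace Ω] (Q : Ensemble N Ω)

lemma entropy_nonneg (E₀ Δ : ℝ) : 0 ≤ Q.entropy E₀ Δ :=
  Real.log_natCast_nonneg _

lemma abs_sub_le_of_mem_shell {E₀ Δ : ℝ} {i j : Conf N} (hi : i ∈ Q.shell E₀ Δ)
    (hj : j ∈ Q.shell E₀ Δ) : |Q.E i - Q.E j| ≤ 2 * |Δ| := by
  simp only [shell, Finset.mem_filter, Finset.mem_univ, true_and] at hi hj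
  rw [abs_le] at hi hj ⊢
  have := le_abs_self Δ
  constructor <;> linarith [hi.1, hi.2, hj.1, hj.2]

lemma codeError_codeSpace_le_one {k : ℕ} (d : ℕ) (s : Fin (2 ^ k) ↪ Conf N) (o : Ω) :
    codeError k d (Q.codeSpace s o) ≤ 1 :=
  codeError_le zero_le_one (isAQECC_one (finrank_span_columns (Q.unitary o) s))

end Ensemble

end ChaosCode

/-! ### The bound on the Lyapunov exponent. -/

theorem theorem2
    -- a sequence of random Hamiltonians on `N n` qubits, `N n → ∞`
    (N : ℕ → ℕ) (hN : Tendsto N atTop atTop)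
    (Ω : ℕ → Type*) [∀ n, MeasurableSpace (Ω n)]
    (P : ∀ n, Measure (Ω n)) [∀ n, IsProbabilityMeasure (P n)]
    (Q : ∀ n, ChaosCode.Ensemble (N n) (Ω n))
    -- microcanonical shells of subextensive width, with extensive entropy
    (E₀ Δ : ℕ → ℝ)
    (hΔ : Δ =o[atTop] fun n => (N n : ℝ))
    (hS : (fun n => (N n : ℝ)) =O[atTop] fun n => (Q n).entropy (E₀ n) (Δ n))
    -- eigenstate thermalization for `d n`-local observables
    (d : ℕ → ℕ) (β c : ℝ) (hβ : 0 < β)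
    (hETH : ∀ n, (Q n).SatisfiesETH (P n) (d n) (E₀ n) (Δ n) β c)
    -- the Lyapunov exponent, read off from ensemble-averaged correlators of local observables
    (A : ∀ n, ChaosCode.Op (N n)) (hA : ∀ n, ChaosCode.IsLocalObservable (d n) (A n))
    (lam : ℝ)
    (hlam : ChaosCode.IsLyapunovExponent
      (fun n t => ∫ o, ChaosCode.twoPoint ((Q n).hamiltonian o) (A n) β t ∂(P n))
      (fun n t => ∫ o, ChaosCode.otoc ((Q n).hamiltonian o) (A n) β t ∂(P n)) lam)
    -- saturation of the chaos bound
    (hsat : lam = 2 * Real.pi / β)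
    -- codes spanned by `2 ^ k n` eigenstates in the shell
    (k : ℕ → ℕ) (s : ∀ n, Fin (2 ^ k n) ↪ ChaosCode.Conf (N n))
    (hs : ∀ n r, s n r ∈ (Q n).shell (E₀ n) (Δ n)) :
    Tendsto (fun n => P n {o | ∀ r r' : Fin (2 ^ k n),
        let w : ℝ := (Q n).E (s n r) - (Q n).E (s n r')
        let S : ℝ := (Q n).entropy (E₀ n) (Δ n)
        let ε : ℝ := ChaosCode.codeError (k n) (d n) ((Q n).codeSpace (s n) o)
        0 < ε →
          0 < 2 * Real.log (2 ^ (d n + 2 * k n) / ε) - S / 2 ∧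
          Real.pi * |w| / (2 * Real.log (2 ^ (d n + 2 * k n) / ε) - S / 2) ≤ lam})
      atTop (𝓝 1) := by
  -- The polynomial factor 16 (N+1)² (|c|+1)² of the code error is the square of this constant times
  -- N + 1.
  have ha : 0 < 4 * (|c| + 1) := by positivity
  have hev := ChaosCode.eventually_subextensive_lt hN hΔ hS
    (fun n => (Q n).entropy_nonneg (E₀ n) (Δ n)) β ha
  have hlow : Tendsto (fun n => 1 - ENNReal.ofReal (1 / ((N n : ℝ) + 1))) atTop (𝓝 1) := by
    have h1 : Tendsto (fun n => ENNReal.ofReal (1 / ((N n : ℝ) + 1))) atTop (𝓝 0) := by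
      rw [← ENNReal.ofReal_zero]
      exact ENNReal.tendsto_ofReal (tendsto_one_div_add_atTop_nhds_zero_nat.comp hN)
    simpa using ENNReal.Tendsto.sub tendsto_const_nhds h1 (Or.inl ENNReal.one_ne_top)
  refine tendsto_of_tendsto_of_tendsto_of_le_of_le' hlow tendsto_const_nhds ?_
    (Eventually.of_forall fun n => prob_le_one)
  filter_upwards [hev] with n hn
  refine ((hETH n).prob_codeError_le hβ (s n) (hs n)).trans (measure_mono ?_)
  intro o ho r r' w S ε hε
  have ho' : ε ≤ √(2 ^ (3 * d n) * 2 ^ (4 * k n) * (4 * (|c| + 1) * (N n + 1)) ^ 2 *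
      Real.exp (-S)) := by
    refine le_trans ho (le_of_eq (congrArg Real.sqrt ?_))
    ring
  have hD := ChaosCode.log_le_of_le_one_of_le_sqrt hε (by positivity)
    ((Q n).codeError_codeSpace_le_one (d n) (s n) o) ho'
  have hw : |w| ≤ 2 * |Δ n| := (Q n).abs_sub_le_of_mem_shell (hs n r) (hs n r')
  set D := 2 * Real.log (2 ^ (d n + 2 * k n) / ε) - S / 2 with hDdef
  have hlt : β * |Δ n| < D := by
    have : β * |Δ n| + 4 / 3 * Real.log (4 * (|c| + 1) * (N n + 1)) < S / 6 := hn
    linarith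
  have hpos : 0 < D := lt_of_le_of_lt (by positivity) hlt
  refine ⟨hpos, ?_⟩
  rw [div_le_iff₀ hpos, hsat, div_mul_eq_mul_div, le_div_iff₀ hβ]
  have h2 : |w| * β ≤ 2 * D := by nlinarith
  calc Real.pi * |w| * β = Real.pi * (|w| * β) := by ring
    _ ≤ Real.pi * (2 * D) := mul_le_mul_of_nonneg_left h2 Real.pi_pos.le
    _ = _ := by ring
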